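/- All graphs are finite and simple. A graph is biconnected if it is connected and has no cut vertex; a block of $G$ is a maximal biconnected subgraph of $G$, and it is non-trivial if it has at least two vertices. A graph is chordal if it has no induced cycle of length at least $4$. Fix an integer $d\ge 2$ and a class $\mathcal P$ of graphs, closed under isomorphism, that consists of chordal graphs and is block-hereditary: every biconnected induced subgraph of a member of $\mathcal P$ is in $\mathcal P$. A $d$-labeled $\mathcal P$-block graph is a graph $G$ all of whose blocks are in $\mathcal P$, with a labeling $L_G:V(G)\to[d]=\{1,\dots,d\}$ that is injective on every block. Label-isomorphic means isomorphic by a label-preserving isomorphism. $X$ is partially label-isomorphic to $Q$ if $X$ is label-isomorphic to the subgraph of $Q$ induced by the vertices whose labels occur in $X$. Let $\mathcal U_d$ be the set of biconnected $d$-labeled $\mathcal P$-block graphs, where label-isomorphic graphs are regarded as equal. A boundaried graph $(G,S)$ is a graph $G$ with a set $S\subseteq V(G)$. $(G,S)$ and $(H,S)$ are compatible if $V(G)\setminus S$ and $V(H)\setminus S$ are disjoint, $G[S]=H[S]$, and the labelings agree on $S$; their sum $(G,S)\oplus(H,S)$ is then the union of $G$ and $H$, with the common extension of the two labelings. $\operatorname{Block}(G,S)$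 is the set of non-trivial blocks of $G[S]$. An $S$-block of $G$ is a block of $G$ that contains an edge of $G[S]$; each $B\in\operatorname{Block}(G,S)$ lies in a unique $S$-block of $G$. $\mathbf{Aux}(G,S)$ is the bipartite graph whose two sides are the set of components of $G$ and the set of components of $G[S]$, with $C_1$ adjacent to $C_2$ if and only if $C_2$ is contained in $C_1$; its boundary is the set of components of $G[S]$. $\mathbf{Aux}(G,S)\oplus\mathbf{Aux}(H,S)$ is the disjoint union of the two graphs with the two copies of the common boundary identified. A characteristic of $(G,S)$ with labeling $L$ is a pair $(g,h)$ of functions $g:\operatorname{Block}(G,S)\to\mathcal U_d$ and $h:\operatorname{Block}(G,S)\to 2^{[d]}$ such that for every $B\in\operatorname{Block}(G,S)$ and the $S$-block $X$ of $G$ containing $B$: (a) $X$ is partially label-isomorphic to $g(B)$; (b) $g(B')=g(B)$ for every $B'\in\operatorname{Block}(G,S)$ contained in $X$; (c) $h(B)=L(N_X(V(B))\setminus S)$; (d) for every $w\in V(X)$ such that $w\notin S$ or $\{w\}=V(X)\cap V(C)$ for some component $C$ of $G[S]$, the graph $X[N_X[w]]$ is label-isomorphic to $g(B)[N_{g(B)}[z]]$,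 where $z$ is the vertex of $g(B)$ with label $L(w)$. The sum $(G,S)\oplus(H,S)$ respects $(g,h)$ if for every $B\in\operatorname{Block}(G,S)$ the $S$-block of $(G,S)\oplus(H,S)$ containing $B$ is label-isomorphic to $g(B)$. Theorem. Let $(G_1,S)$, $(G_2,S)$ and $(H,S)$ be $d$-labeled $\mathcal P$-block graphs such that each $(G_i,S)$, $i\in\{1,2\}$, is compatible with $(H,S)$, the pair $(g,h)$ is a characteristic of both $(G_1,S)$ and $(G_2,S)$, and $\mathbf{Aux}(G_2,S)\oplus\mathbf{Aux}(H,S)$ has no cycles. If $(G_1,S)\oplus(H,S)$ is a $d$-labeled $\mathcal P$-block graph that respects $(g,h)$, then $(G_2,S)\oplus(H,S)$ is a $d$-labeled $\mathcal P$-block graph that respects $(g,h)$. -/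

import Mathlib

universe u

/-- A graph whose vertex set is a subset `G.verts` of the ambient type `V`. The union of two such
graphs is `G ⊔ H`, and `G[X]` is `G.induce X` (for `X ⊆ G.verts`). -/
abbrev VGraph (V : Type u) : Type u := (⊤ : SimpleGraph V).Subgraph

/-! ### Biconnected and chordal graphs, blocks -/

/-- `v` is a cut vertex: its deletion increases the number of connected components. -/
def IsCutVertex {W : Type u} (G : SimpleGraph W) (v : W) : Prop :=
  ENat.card G.ConnectedComponent < ENat.card (G.induce {v}ᶜ).ConnectedComponent

/-- Biconnected: connected (so nonempty) without cut vertices. -/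
def IsBiconnected {W : Type u} (G : SimpleGraph W) : Prop :=
  G.Connected ∧ ∀ v, ¬ IsCutVertex G v

/-- No induced cycle of length at least four. -/
def IsChordalGraph {W : Type u} (G : SimpleGraph W) : Prop :=
  ∀ n : ℕ, 4 ≤ n → IsEmpty (SimpleGraph.cycleGraph n ↪g G)

/-- `B` is a block of `G`: a maximal biconnected subgraph. -/
def IsBlockOf {V : Type u} (G B : VGraph V) : Prop :=
  Maximal (fun K : VGraph V => K ≤ G ∧ IsBiconnected K.coe) B

/-! ### Graph classes -/

/-- A property of graphs on types of the universe `u`. -/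
abbrev GraphClass : Type (u + 1) := ∀ ⦃W : Type u⦄, SimpleGraph W → Prop

/-- The class is closed under isomorphism. -/
def GraphClass.IsoClosed (P : GraphClass.{u}) : Prop :=
  ∀ ⦃W W' : Type u⦄ (G : SimpleGraph W) (G' : SimpleGraph W'), Nonempty (G ≃g G') → P G → P G'

/-- Every biconnected induced subgraph of a member is a member. -/
def GraphClass.BlockHereditary (P : GraphClass.{u}) : Prop :=
  ∀ ⦃W : Type u⦄ (G : SimpleGraph W), P G →
    ∀ X : Set W, IsBiconnected (G.induce X) → P (G.induce X)

/-- Every member is chordal. -/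
def GraphClass.Chordal (P : GraphClass.{u}) : Prop :=
  ∀ ⦃W : Type u⦄ (G : SimpleGraph W), P G → IsChordalGraph G

/-- `G` is a `P`-block graph: each of its blocks belongs to `P`. -/
def IsPBlockGraph (P : GraphClass.{u}) {V : Type u} (G : VGraph V) : Prop :=
  ∀ B, IsBlockOf G B → P B.coe

/-! ### Labelings

The label set `[d]` is `Fin d`. A labeling of `G` is a function on the ambient type, of which only
the values on `G.verts` are used. -/

/-- `L` is a block `d`-labeling of `G`: it is injective on each block. -/
def IsBlockLabeling {V : Type u} {d : ℕ} (G : VGraph V) (L : V → Fin d) : Prop :=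
  ∀ B, IsBlockOf G B → Set.InjOn L B.verts

/-- `G` with `L` is a (finite) `d`-labeled `P`-block graph. -/
def IsLabeledPBlockGraph (P : GraphClass.{u}) {V : Type u} {d : ℕ} (G : VGraph V)
    (L : V → Fin d) : Prop :=
  G.verts.Finite ∧ IsBlockLabeling G L ∧ IsPBlockGraph P G

/-- There is a label preserving isomorphism from `G` to `G'`. -/
def LabelIso {V V' : Type u} {d : ℕ} (G : VGraph V) (L : V → Fin d)
    (G' : VGraph V') (L' : V' → Fin d) : Prop :=
  ∃ e : G.coe ≃g G'.coe, ∀ v, L' (e v) = L v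

/-- `H` is label-isomorphic to the subgraph of `G` induced by the vertices with labels in `H`. -/
def PartialLabelIso {V V' : Type u} {d : ℕ} (H : VGraph V) (LH : V → Fin d)
    (G : VGraph V') (LG : V' → Fin d) : Prop :=
  LabelIso H LH (G.induce {q | q ∈ G.verts ∧ LG q ∈ LH '' H.verts}) LG

/-- A graph together with a labeling; no condition is imposed yet. -/
structure LabeledGraph (d : ℕ) : Type (u + 1) where
  carrier : Type u
  graph : VGraph carrier
  label : carrier → Fin d

/-- `Q` is a biconnected `d`-labeled `P`-block graph. These graphs form the set `U_d`; two of them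
are the same element of `U_d` when they are label-isomorphic. -/
def LabeledGraph.MemU (P : GraphClass.{u}) {d : ℕ} (Q : LabeledGraph.{u} d) : Prop :=
  IsLabeledPBlockGraph P Q.graph Q.label ∧ IsBiconnected Q.graph.coe

/-! ### Boundaried graphs -/

/-- `(G, S)` and `(H, S)`, with labelings `LG` and `LH`, are compatible boundaried graphs. -/
structure Compatible {V : Type u} {d : ℕ} (S : Set V) (G : VGraph V) (LG : V → Fin d)
    (H : VGraph V) (LH : V → Fin d) : Prop where
  subset_left : S ⊆ G.verts
  subset_right : S ⊆ H.verts
  disjoint : Disjoint (G.verts \ S) (H.verts \ S)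
  induce_eq : G.induce S = H.induce S
  label_eq : Set.EqOn LG LH S

/-- The sum `(G, S) ⊕ (H, S)`. If `G` and `H` agree on `S` and are disjoint outside `S`, identifying
the two copies of `S` gives the union of `G` and `H`. -/
def boundariedSum {V : Type u} (G H : VGraph V) : VGraph V := G ⊔ H

open Classical in
/-- `L_G ⊕ L_H`: the label in `G` on `V(G)`, and the label in `H` elsewhere. -/
noncomputable def sumLabel {V : Type u} {d : ℕ} (G : VGraph V) (LG LH : V → Fin d) : V → Fin d :=
  fun v => if v ∈ G.verts then LG v else LH v

/-- `Block(G, S)`: the blocks of `G[S]` with at least two vertices. -/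
def boundaryBlocks {V : Type u} (G : VGraph V) (S : Set V) : Set (VGraph V) :=
  {B | IsBlockOf (G.induce S) B ∧ B.verts.Nontrivial}

/-- `X` is an `S`-block of `G`: a block containing an edge of `G[S]`. In a finite graph, every
non-trivial block of `G[S]` is contained in exactly one `S`-block of `G`. -/
def IsSBlock {V : Type u} (G : VGraph V) (S : Set V) (X : VGraph V) : Prop :=
  IsBlockOf G X ∧ ∃ u v, X.Adj u v ∧ (G.induce S).Adj u v

/-- The vertex sets of the connected components of `G`. -/
def componentSets {V : Type u} (G : VGraph V) : Set (Set V) :=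
  {C | ∃ c : G.coe.ConnectedComponent, C = Subtype.val '' c.supp}

/-- `Aux(G, S)`: the bipartite graph with the components of `G` on one side and those of `G[S]` on
the other (the boundary), where adjacency is containment. A component `C` of `G` is the vertex
`inl (i, C)`, a component `D` of `G[S]` is the vertex `inr D`; the tag `i` keeps the vertices
outside the boundary apart when two such graphs are summed. -/
def auxGraph {V : Type u} (i : Bool) (G : VGraph V) (S : Set V) :
    VGraph ((Bool × Set V) ⊕ Set V) where
  verts := {x | (∃ C ∈ componentSets G, x = Sum.inl (i, C)) ∨
    ∃ D ∈ componentSets (G.induce S), x = Sum.inr D}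
  Adj x y := ∃ C ∈ componentSets G, ∃ D ∈ componentSets (G.induce S), D ⊆ C ∧
    ((x = Sum.inl (i, C) ∧ y = Sum.inr D) ∨ (x = Sum.inr D ∧ y = Sum.inl (i, C)))
  adj_sub := by
    rintro x y ⟨C, -, D, -, -, ⟨rfl, rfl⟩ | ⟨rfl, rfl⟩⟩ <;> simp
  edge_vert := by
    rintro x y ⟨C, hC, D, hD, -, ⟨rfl, rfl⟩ | ⟨rfl, rfl⟩⟩
    · exact Or.inl ⟨C, hC, rfl⟩
    · exact Or.inr ⟨D, hD, rfl⟩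
  symm := by
    constructor
    rintro x y ⟨C, hC, D, hD, h, h'⟩
    exact ⟨C, hC, D, hD, h, h'.symm.imp And.symm And.symm⟩

/-- `Aux(G, S) ⊕ Aux(H, S)`, for `G[S] = H[S]`. -/
def auxSum {V : Type u} (G H : VGraph V) (S : Set V) : VGraph ((Bool × Set V) ⊕ Set V) :=
  boundariedSum (auxGraph false G S) (auxGraph true H S)

/-! ### Characteristics -/

/-- `N_X(A)`: the vertices outside `A` with a neighbor in `A`. -/
def setNeighbors {V : Type u} (X : VGraph V) (A : Set V) : Set V :=
  {v | ∃ a ∈ A, X.Adj a v} \ A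

/-- `X[N_X[w]]`: the subgraph induced by `w` and its neighbors. -/
def closedNeighborhood {V : Type u} (X : VGraph V) (w : V) : VGraph V :=
  X.induce (insert w (X.neighborSet w))

/-- `(g, h)` is a characteristic of `(G, S)` with labeling `L`. Only the values of `g` and `h` on
`Block(G, S)` matter; there `g` takes values in `U_d` and `h` is a set of labels. The quantifier
over `X` speaks about the unique `S`-block of `G` that contains `B`. -/
structure IsCharacteristic (P : GraphClass.{u}) {V : Type u} {d : ℕ} (G : VGraph V) (S : Set V)
    (L : V → Fin d) (g : VGraph V → LabeledGraph.{u} d) (h : VGraph V → Set (Fin d)) :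
    Prop where
  memU : ∀ B ∈ boundaryBlocks G S, (g B).MemU P
  label_isomorphism : ∀ B ∈ boundaryBlocks G S, ∀ X, IsSBlock G S X → B ≤ X →
    PartialLabelIso X L (g B).graph (g B).label
  coincidence : ∀ B ∈ boundaryBlocks G S, ∀ X, IsSBlock G S X → B ≤ X →
    ∀ B' ∈ boundaryBlocks G S, B' ≤ X →
      LabelIso (g B').graph (g B').label (g B).graph (g B).label
  neighborhood : ∀ B ∈ boundaryBlocks G S, ∀ X, IsSBlock G S X → B ≤ X →
    h B = L '' (setNeighbors X B.verts \ S)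
  completeness : ∀ B ∈ boundaryBlocks G S, ∀ X, IsSBlock G S X → B ≤ X →
    ∀ w, (w ∈ X.verts \ S ∨ ∃ C ∈ componentSets (G.induce S), {w} = X.verts ∩ C) →
      ∀ z ∈ (g B).graph.verts, (g B).label z = L w →
        LabelIso (closedNeighborhood X w) L (closedNeighborhood (g B).graph z) (g B).label

/-- `(G, S) ⊕ (H, S)` respects `(g, h)`: for each `B` in `Block(G, S)`, the `S`-block of the sum
that contains `B` is label-isomorphic to `g(B)`. (The function `h` plays no role.) -/
def SumRespects {V : Type u} {d : ℕ} (S : Set V) (G : VGraph V) (LG : V → Fin d)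
    (H : VGraph V) (LH : V → Fin d) (g : VGraph V → LabeledGraph.{u} d) : Prop :=
  ∀ B ∈ boundaryBlocks G S, ∀ X, IsSBlock (boundariedSum G H) S X → B ≤ X →
    LabelIso X (sumLabel G LG LH) (g B).graph (g B).label

/-!
A sum of two graphs along `S` is rebuilt block by block from its two sides.

*Blocks and sides.* The acyclicity of the auxiliary graph says that the components of the two sides
are glued along the components of `G[S]` in the shape of a forest. A walk that leaves the components
containing a vertex `v` therefore comes back through the component of `G[S]` through which it left,
and since this component is connected the excursion can be avoided. Consequently, two edges at `v`
in the same block of the sum are linked by a chain of edges at `v`, consecutive ones lying in the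
same block of one side (`IsAmalgam.sideLink_of_avoidReach`). It follows that a block of the sum
without an edge of `G[S]` is a block of one side (`IsAmalgam.block_cases`), and that the value of
`g` is constant along a block `X` of the sum that contains a non-trivial block `B` of `G[S]`
(`BoundaryModel.hasModelAt`).

*The role of chordality.* Such a block `X` has to be identified with `g B` through the labels. A
map from a connected graph to a chordal graph that is an induced embedding on the neighborhood of
each vertex is an induced embedding: the image of a shortest walk is a walk without repetitions and
chords at distance two, and in a chordal graph such a walk is an induced path
(`IsChordalGraph.embedding_of_local`). This is applied twice: to the graph induced on the neighbors
of a vertex `w` of `X`, and then to `X`. For the first application, at a neighbor `c` of `w`, the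
common neighbors of `w` and `c` lie in a single side, or `wc` is an edge of some block `B'` of
`G[S]` and those outside `S` have different and nonadjacent labels when they come from
different sides. The latter holds in the sum with `G₁`, and the set `h B'` carries it over to the sum
with `G₂`. Surjectivity is obtained likewise, from the neighborhoods in `g B`, which are
connected as `g B` is chordal and biconnected (`BoundaryModel.label_neighbor_surjective`).

*What the two sums provide.* The conditions on the side `G₂` are those of a characteristic
(`IsCharacteristic.sideModel`). The side `H` satisfies the same conditions because it is a side of
the sum with `G₁`, whose blocks are known to be the graphs `g B` (`IsAmalgam.sideModel_of_sum`).
-/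

/-! ### Walks in subgraphs and biconnectivity -/

section Biconnected

variable {V : Type u}

/-- `x` and `y` are joined by a walk of `G` that avoids `v`. -/
def AvoidReach (G : VGraph V) (v : V) : V → V → Prop :=
  Relation.ReflTransGen fun x y => G.Adj x y ∧ x ≠ v ∧ y ≠ v

/-- `x` and `y` are joined by a walk of `G`. The ambient type carries the relation, so that walks of
different subgraphs can be compared. -/
def WalkReach (G : VGraph V) : V → V → Prop :=
  Relation.ReflTransGen G.Adj

theorem AvoidReach.mono {G G' : VGraph V} (h : G ≤ G') {v x y : V} (hxy : AvoidReach G v x y) :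
    AvoidReach G' v x y :=
  Relation.ReflTransGen.mono (fun _ _ h1 => ⟨h.2 h1.1, h1.2⟩) _ _ hxy

theorem WalkReach.mono {G G' : VGraph V} (h : G ≤ G') {x y : V} (hxy : WalkReach G x y) :
    WalkReach G' x y :=
  Relation.ReflTransGen.mono (fun _ _ h1 => h.2 h1) _ _ hxy

theorem AvoidReach.symm {G : VGraph V} {v x y : V} (h : AvoidReach G v x y) :
    AvoidReach G v y x :=
  have : Std.Symm fun x y => G.Adj x y ∧ x ≠ v ∧ y ≠ v :=
    ⟨fun _ _ h' => ⟨h'.1.symm, h'.2.2, h'.2.1⟩⟩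
  Relation.ReflTransGen.stdSymm.symm _ _ h

theorem WalkReach.symm {G : VGraph V} {x y : V} (h : WalkReach G x y) : WalkReach G y x :=
  have : Std.Symm G.Adj := ⟨fun _ _ h' => h'.symm⟩
  Relation.ReflTransGen.stdSymm.symm _ _ h

theorem WalkReach.trans {G : VGraph V} {x y z : V} (h : WalkReach G x y) (h' : WalkReach G y z) :
    WalkReach G x z :=
  Relation.ReflTransGen.trans h h'

theorem AvoidReach.trans {G : VGraph V} {v x y z : V} (h : AvoidReach G v x y)
    (h' : AvoidReach G v y z) : AvoidReach G v x z :=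
  Relation.ReflTransGen.trans h h'

theorem AvoidReach.single {G : VGraph V} {v x y : V} (h : G.Adj x y) (hx : x ≠ v) (hy : y ≠ v) :
    AvoidReach G v x y :=
  Relation.ReflTransGen.single ⟨h, hx, hy⟩

theorem AvoidReach.eq_or_mem {G : VGraph V} {v x y : V} (h : AvoidReach G v x y) :
    x = y ∨ x ∈ G.verts ∧ y ∈ G.verts := by
  rcases Relation.ReflTransGen.cases_head h with h0 | ⟨c, hc, -⟩
  · exact Or.inl h0
  · rcases Relation.ReflTransGen.cases_tail h with h0 | ⟨c', -, hc'⟩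
    · exact Or.inl h0.symm
    · exact Or.inr ⟨hc.1.fst_mem, hc'.1.snd_mem⟩

theorem AvoidReach.right_mem {G : VGraph V} {v x y : V} (h : AvoidReach G v x y)
    (hx : x ∈ G.verts) : y ∈ G.verts := by
  rcases h.eq_or_mem with rfl | h
  exacts [hx, h.2]

theorem WalkReach.right_mem {G : VGraph V} {x y : V} (h : WalkReach G x y)
    (hx : x ∈ G.verts) : y ∈ G.verts := by
  rcases Relation.ReflTransGen.cases_tail h with rfl | ⟨c', -, hc'⟩
  exacts [hx, hc'.snd_mem]

theorem WalkReach.avoid {G : VGraph V} {v x y : V} (h : WalkReach G x y)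
    (hv : ¬ WalkReach G x v) : AvoidReach G v x y := by
  induction h with
  | refl => exact .refl
  | @tail b c hb hbc ih =>
    refine ih.tail ⟨hbc, ?_, ?_⟩
    · rintro rfl; exact hv hb
    · rintro rfl; exact hv (hb.tail hbc)

/-- A walk that leaves `w` for good leaves it through some neighbor `c`. -/
theorem WalkReach.exists_first_step {G : VGraph V} {w y : V} (h : WalkReach G w y) (hne : y ≠ w) :
    ∃ c, G.Adj w c ∧ AvoidReach G w c y := by
  induction h with
  | refl => exact absurd rfl hne
  | @tail x y _ hxy ih =>
    by_cases hx : x = w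
    · subst hx
      exact ⟨y, hxy, .refl⟩
    · obtain ⟨c, hc, hcx⟩ := ih hx
      exact ⟨c, hc, hcx.tail ⟨hxy, hx, hne⟩⟩

/-- Biconnectivity in terms of walks on the ambient type, see `isBiconnected_iff`. -/
structure WalkBiconnected (Y : VGraph V) : Prop where
  nonempty : Y.verts.Nonempty
  reach : ∀ x ∈ Y.verts, ∀ y ∈ Y.verts, WalkReach Y x y
  avoid : ∀ v, ∀ x ∈ Y.verts, ∀ y ∈ Y.verts, x ≠ v → y ≠ v → AvoidReach Y v x y

theorem walkReach_iff_reachable {Y : VGraph V} (x y : Y.verts) :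
    Y.coe.Reachable x y ↔ WalkReach Y x y := by
  rw [SimpleGraph.reachable_iff_reflTransGen]
  constructor
  · intro h
    exact Relation.ReflTransGen.lift Subtype.val (fun _ _ h => h) _ _ h
  · intro h
    have key : ∀ z, WalkReach Y x z → ∀ hz : z ∈ Y.verts,
        Relation.ReflTransGen Y.coe.Adj x ⟨z, hz⟩ := by
      intro z h
      induction h with
      | refl => intro _; exact .refl
      | @tail b c _ hbc ih => intro hz; exact (ih hbc.fst_mem).tail hbc
    exact key y h y.2

theorem avoidReach_iff_reachable {Y : VGraph V} (v : Y.verts) (x y : ({v}ᶜ : Set Y.verts)) :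
    (Y.coe.induce {v}ᶜ).Reachable x y ↔ AvoidReach Y v x y := by
  rw [SimpleGraph.reachable_iff_reflTransGen]
  constructor
  · intro h
    refine Relation.ReflTransGen.lift (fun z : ({v}ᶜ : Set Y.verts) => (z : V)) ?_ _ _ h
    intro a b hab
    exact ⟨hab, fun h => a.2 (Subtype.ext h), fun h => b.2 (Subtype.ext h)⟩
  · intro h
    have key : ∀ z, AvoidReach Y v x z → ∀ (hz : z ∈ Y.verts)
        (hz' : (⟨z, hz⟩ : Y.verts) ∈ ({v}ᶜ : Set Y.verts)),
        Relation.ReflTransGen (Y.coe.induce {v}ᶜ).Adj x ⟨⟨z, hz⟩, hz'⟩ := by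
      intro z h
      induction h with
      | refl => intro _ _; exact .refl
      | @tail b c _ hbc ih =>
        intro hz hz'
        exact (ih hbc.1.fst_mem (fun h => hbc.2.1 (congrArg Subtype.val h))).tail hbc.1
    exact key y h y.1.2 y.2

theorem isBiconnected_iff {Y : VGraph V} : IsBiconnected Y.coe ↔ WalkBiconnected Y := by
  have hcut : ∀ v : Y.verts, Y.coe.Connected → (¬ IsCutVertex Y.coe v ↔
      ∀ x y : ({v}ᶜ : Set Y.verts), (Y.coe.induce {v}ᶜ).Reachable x y) := by
    intro v hconn
    have h1 : ENat.card Y.coe.ConnectedComponent = 1 := by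
      have := hconn.preconnected.subsingleton_connectedComponent
      have : Nonempty Y.coe.ConnectedComponent := ⟨Y.coe.connectedComponentMk v⟩
      exact le_antisymm ((ENat.card_le_one_iff_subsingleton _).2 inferInstance)
        ((ENat.one_le_card_iff_nonempty _).2 this)
    rw [IsCutVertex, h1, not_lt, ENat.card_le_one_iff_subsingleton]
    constructor
    · intro h x y
      exact SimpleGraph.ConnectedComponent.exact (h.elim _ _)
    · intro h
      constructor
      intro a b
      induction a using SimpleGraph.ConnectedComponent.ind
      induction b using SimpleGraph.ConnectedComponent.ind
      exact SimpleGraph.ConnectedComponent.sound (h _ _)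
  constructor
  · rintro ⟨hc, hv⟩
    obtain ⟨x0⟩ := hc.nonempty
    have hreach : ∀ x ∈ Y.verts, ∀ y ∈ Y.verts, WalkReach Y x y := fun x hx y hy =>
      (walkReach_iff_reachable ⟨x, hx⟩ ⟨y, hy⟩).1 (hc.preconnected _ _)
    refine ⟨⟨x0, x0.2⟩, hreach, ?_⟩
    intro v x hx y hy hxv hyv
    by_cases hvY : v ∈ Y.verts
    · exact (avoidReach_iff_reachable ⟨v, hvY⟩ ⟨⟨x, hx⟩, fun h => hxv (congrArg Subtype.val h)⟩
        ⟨⟨y, hy⟩, fun h => hyv (congrArg Subtype.val h)⟩).1 ((hcut _ hc).1 (hv _) _ _)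
    · exact (hreach x hx y hy).avoid fun h => hvY (h.right_mem hx)
  · rintro ⟨⟨x0, hx0⟩, hreach, havoid⟩
    have hc : Y.coe.Connected := by
      have : Nonempty Y.verts := ⟨⟨x0, hx0⟩⟩
      exact ⟨fun x y => (walkReach_iff_reachable x y).2 (hreach x x.2 y y.2)⟩
    refine ⟨hc, fun v => (hcut v hc).2 fun x y => (avoidReach_iff_reachable v x y).2 ?_⟩
    exact havoid v x x.1.2 y y.1.2 (fun h => x.2 (Subtype.ext h)) (fun h => y.2 (Subtype.ext h))

theorem WalkBiconnected.exists_adj {Y : VGraph V} (hY : WalkBiconnected Y) {x y : V}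
    (hx : x ∈ Y.verts) (hy : y ∈ Y.verts) (hne : x ≠ y) : ∃ c, Y.Adj x c :=
  let ⟨c, hc, _⟩ := (hY.reach x hx y hy).exists_first_step hne.symm
  ⟨c, hc⟩

/-- The union of two biconnected graphs with two common vertices is biconnected: after the deletion
of a vertex, one of the two remains and is connected to everything else. -/
theorem WalkBiconnected.sup {Y Y' : VGraph V} (hY : WalkBiconnected Y) (hY' : WalkBiconnected Y')
    {x y : V} (hxy : x ≠ y) (hx : x ∈ Y.verts) (hx' : x ∈ Y'.verts) (hy : y ∈ Y.verts)
    (hy' : y ∈ Y'.verts) : WalkBiconnected (Y ⊔ Y') := by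
  have hr : ∀ z ∈ (Y ⊔ Y').verts, WalkReach (Y ⊔ Y') x z := by
    rintro z (hz | hz)
    · exact (hY.reach x hx z hz).mono le_sup_left
    · exact (hY'.reach x hx' z hz).mono le_sup_right
  refine ⟨⟨x, Or.inl hx⟩, fun a ha b hb => (hr a ha).symm.trans (hr b hb), ?_⟩
  intro v
  obtain ⟨c, hcv, hc, hc'⟩ : ∃ c, c ≠ v ∧ c ∈ Y.verts ∧ c ∈ Y'.verts := by
    by_cases h : x = v
    · exact ⟨y, fun h' => hxy (h.trans h'.symm), hy, hy'⟩
    · exact ⟨x, h, hx, hx'⟩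
  have hav : ∀ z ∈ (Y ⊔ Y').verts, z ≠ v → AvoidReach (Y ⊔ Y') v c z := by
    rintro z (hz | hz) hzv
    · exact (hY.avoid v c hc z hz hcv hzv).mono le_sup_left
    · exact (hY'.avoid v c hc' z hz hcv hzv).mono le_sup_right
  intro a ha b hb hav' hbv
  exact (hav a ha hav').symm.trans (hav b hb hbv)

theorem walkBiconnected_subgraphOfAdj {a b : V} (h : (⊤ : SimpleGraph V).Adj a b) :
    WalkBiconnected (SimpleGraph.subgraphOfAdj (⊤ : SimpleGraph V) h) := by
  have hadj : (SimpleGraph.subgraphOfAdj (⊤ : SimpleGraph V) h).Adj a b := by simp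
  refine ⟨⟨a, by simp⟩, ?_, ?_⟩
  · rintro x (rfl | rfl) y (rfl | rfl)
    exacts [.refl, .single hadj, .single hadj.symm, .refl]
  · rintro v x (rfl | rfl) y (rfl | rfl) hx hy
    exacts [.refl, .single hadj hx hy, .single hadj.symm hx hy, .refl]

theorem walkBiconnected_singletonSubgraph (v : V) :
    WalkBiconnected (SimpleGraph.singletonSubgraph (⊤ : SimpleGraph V) v) := by
  refine ⟨⟨v, by simp⟩, ?_, ?_⟩
  · rintro x rfl y rfl; exact .refl
  · rintro w x rfl y rfl _ _; exact .refl

/-- Two neighbors of `v` that are joined by a walk avoiding `v` lie with `v` on a cycle, and the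
vertices of this cycle induce a biconnected subgraph. -/
theorem AvoidReach.exists_walkBiconnected {K : VGraph V} {v a b : V} (hva : K.Adj v a)
    (hvb : K.Adj v b) (hab : AvoidReach K v a b) :
    ∃ Y ≤ K, WalkBiconnected Y ∧ Y.Adj v a ∧ Y.Adj v b := by
  classical
  let R : SimpleGraph V :=
    { Adj := fun x y => K.Adj x y ∧ x ≠ v ∧ y ≠ v
      symm := ⟨fun _ _ h => ⟨h.1.symm, h.2.2, h.2.1⟩⟩
      loopless := ⟨fun _ h => h.1.ne rfl⟩ }
  have hR : R.Reachable a b := (SimpleGraph.reachable_iff_reflTransGen a b).2 hab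
  obtain ⟨p, hp⟩ := hR.exists_isPath
  have hvp : v ∉ p.support := by
    intro hv
    have key : ∀ {a b : V} (q : R.Walk a b), a ≠ v → v ∉ q.support := by
      intro a b q
      induction q with
      | nil => intro h; simpa using h.symm
      | cons h q ih =>
        intro hne
        simp only [SimpleGraph.Walk.support_cons, List.mem_cons, not_or]
        exact ⟨hne.symm, ih h.2.2⟩
    exact key p hva.ne.symm hv
  let s : Set V := insert v {x | x ∈ p.support}
  have hwalk : ∀ (x : V) {a y : V} (q : R.Walk a y), (∀ z ∈ q.support, z ∈ p.support) →
      x ∉ q.support → AvoidReach (K.induce s) x a y := by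
    intro x a y q
    induction q with
    | nil => intro _ _; exact .refl
    | cons h q ih =>
      intro hs hx
      simp only [SimpleGraph.Walk.support_cons, List.mem_cons, not_or] at hx
      have hq := q.start_mem_support
      refine .head ⟨⟨Or.inr (hs _ (by simp)), Or.inr (hs _ (by simp)), h.1⟩, Ne.symm hx.1, ?_⟩
        (ih (fun z hz => hs z (by simp [hz])) hx.2)
      rintro rfl
      exact hx.2 hq
  have hstart : ∀ (x y : V) {a : V} (q : R.Walk a x), q.IsPath → K.Adj v a → x ≠ v →
      (∀ z ∈ q.support, z ∈ p.support) → y ∈ q.support → y ≠ x →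
      AvoidReach (K.induce s) x v y := by
    intro x y a q hq hva hxv hs hy hyx
    have hnot : x ∉ (q.takeUntil y hy).support :=
      SimpleGraph.Walk.endpoint_notMem_support_takeUntil hq hy hyx.symm
    have hax : a ≠ x := by
      rintro rfl
      exact hnot (SimpleGraph.Walk.start_mem_support _)
    have hva' : (K.induce s).Adj v a := ⟨Or.inl rfl, Or.inr (hs _ (by simp)), hva⟩
    exact (AvoidReach.single hva' hxv.symm hax).trans
      (hwalk x _ (fun z hz =>
        hs z (SimpleGraph.Walk.support_takeUntil_subset_support _ _ hz)) hnot)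
  have hv : ∀ y ∈ p.support, AvoidReach (K.induce s) v a y := by
    intro y hy
    refine hwalk v (p.takeUntil y hy) (fun z hz => ?_) (fun h => hvp ?_)
    · exact SimpleGraph.Walk.support_takeUntil_subset_support _ _ hz
    · exact SimpleGraph.Walk.support_takeUntil_subset_support _ _ h
  have hadj : ∀ y ∈ p.support, K.Adj v y → (K.induce s).Adj v y := fun y hy h =>
    ⟨Or.inl rfl, Or.inr hy, h⟩
  have hr : ∀ y ∈ s, WalkReach (K.induce s) v y := by
    rintro y (rfl | hy)
    · exact .refl
    · exact Relation.ReflTransGen.head (hadj a (by simp) hva)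
        (Relation.ReflTransGen.mono (fun _ _ h => h.1) _ _ (hv y hy))
  refine ⟨K.induce s, ⟨?_, ?_⟩, ⟨⟨v, Or.inl rfl⟩, ?_, ?_⟩, hadj a (by simp) hva,
    hadj b (by simp) hvb⟩
  · rintro y (rfl | hy)
    · exact hva.fst_mem
    · rcases Relation.ReflTransGen.cases_tail (hv y hy) with rfl | ⟨_, -, hc⟩
      exacts [hva.snd_mem, K.edge_vert hc.1.2.2.symm]
  · exact fun _ _ h => h.2.2
  · exact fun x hx y hy => (hr x hx).symm.trans (hr y hy)
  · intro x y hy z hz hyx hzx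
    by_cases hxv : x = v
    · subst hxv
      have h1 : y ∈ p.support := hy.resolve_left hyx
      have h2 : z ∈ p.support := hz.resolve_left hzx
      exact (hv y h1).symm.trans (hv z h2)
    · by_cases hxs : x ∈ p.support
      · have hall : ∀ y ∈ s, y ≠ x → AvoidReach (K.induce s) x v y := by
          rintro y (rfl | hy) hyx
          · exact .refl
          · have hy' : y ∈ p.support := hy
            rw [← p.take_spec hxs, SimpleGraph.Walk.mem_support_append_iff] at hy'
            rcases hy' with h | h
            · exact hstart x y _ (hp.takeUntil hxs) hva hxv
                (SimpleGraph.Walk.support_takeUntil_subset_support _ _) h hyx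
            · exact hstart x y _ (hp.dropUntil hxs).reverse hvb hxv
                (fun z hz => SimpleGraph.Walk.support_dropUntil_subset_support _ _
                  (by simpa using hz)) (by simpa using h) hyx
        exact (hall y hy hyx).symm.trans (hall z hz hzx)
      · have hxs' : x ∉ s := by rintro (h | h); exacts [hxv h, hxs h]
        refine ((hr y hy).symm.trans (hr z hz)).avoid fun h => hxs' (h.right_mem hy)

end Biconnected

/-! ### Blocks of finite graphs -/

section Blocks

variable {V : Type u}

theorem finite_setOf_subgraph_le {K : VGraph V} (hK : K.verts.Finite) :
    {Y : VGraph V | Y ≤ K}.Finite := by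
  have hinj : Function.Injective fun Y : VGraph V => (Y.verts, {p : V × V | Y.Adj p.1 p.2}) := by
    intro Y Y' h
    rw [Prod.mk.injEq] at h
    refine SimpleGraph.Subgraph.ext h.1 ?_
    funext x y
    exact propext (Set.ext_iff.1 h.2 (x, y))
  refine Set.Finite.subset (Set.Finite.preimage hinj.injOn
    (hK.finite_subsets.prod (hK.prod hK).finite_subsets)) ?_
  intro Y hY
  refine ⟨hY.1, ?_⟩
  rintro ⟨x, y⟩ h
  exact ⟨hY.1 h.fst_mem, hY.1 h.snd_mem⟩

theorem IsBlockOf.le {K X : VGraph V} (hX : IsBlockOf K X) : X ≤ K := hX.prop.1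

theorem IsBlockOf.walkBiconnected {K X : VGraph V} (hX : IsBlockOf K X) : WalkBiconnected X :=
  isBiconnected_iff.1 hX.prop.2

theorem IsBlockOf.eq_of_le {K X Y : VGraph V} (hX : IsBlockOf K X) (hY : WalkBiconnected Y)
    (hYK : Y ≤ K) (hXY : X ≤ Y) : X = Y :=
  Maximal.eq_of_le hX ⟨hYK, isBiconnected_iff.2 hY⟩ hXY

theorem WalkBiconnected.exists_block {K Y : VGraph V} (hK : K.verts.Finite)
    (hY : WalkBiconnected Y) (hYK : Y ≤ K) : ∃ X, IsBlockOf K X ∧ Y ≤ X := by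
  have hfin : {Z : VGraph V | Z ≤ K ∧ IsBiconnected Z.coe}.Finite :=
    (finite_setOf_subgraph_le hK).subset fun _ h => h.1
  obtain ⟨X, hYX, hX⟩ := hfin.exists_le_maximal (show Y ∈ _ from ⟨hYK, isBiconnected_iff.2 hY⟩)
  exact ⟨X, hX, hYX⟩

theorem exists_block_of_adj {K : VGraph V} (hK : K.verts.Finite) {x y : V} (h : K.Adj x y) :
    ∃ X, IsBlockOf K X ∧ X.Adj x y := by
  obtain ⟨X, hX, hle⟩ := (walkBiconnected_subgraphOfAdj (K.adj_sub h)).exists_block hK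
    (SimpleGraph.subgraphOfAdj_le_of_adj K h)
  exact ⟨X, hX, hle.2 (by simp)⟩

/-- A biconnected subgraph that shares two vertices with a block is contained in it. -/
theorem IsBlockOf.le_of_mem {K X Y : VGraph V} (hX : IsBlockOf K X) (hY : WalkBiconnected Y)
    (hYK : Y ≤ K) {x y : V} (hxy : x ≠ y) (hx : x ∈ X.verts) (hy : y ∈ X.verts)
    (hx' : x ∈ Y.verts) (hy' : y ∈ Y.verts) : Y ≤ X := by
  have := hX.eq_of_le (hX.walkBiconnected.sup hY hxy hx hx' hy hy') (sup_le hX.le hYK) le_sup_left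
  rw [this]
  exact le_sup_right

theorem IsBlockOf.le_of_adj {K X Y : VGraph V} (hX : IsBlockOf K X) (hY : WalkBiconnected Y)
    (hYK : Y ≤ K) {x y : V} (hx : X.Adj x y) (hy : Y.Adj x y) : Y ≤ X :=
  hX.le_of_mem hY hYK hx.ne hx.fst_mem hx.snd_mem hy.fst_mem hy.snd_mem

/-- Blocks are induced subgraphs. -/
theorem IsBlockOf.adj_of_mem {K X : VGraph V} (hX : IsBlockOf K X) {x y : V} (hx : x ∈ X.verts)
    (hy : y ∈ X.verts) (h : K.Adj x y) : X.Adj x y := by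
  have hle := hX.le_of_mem (walkBiconnected_subgraphOfAdj (K.adj_sub h))
    (SimpleGraph.subgraphOfAdj_le_of_adj K h) h.ne hx hy (by simp) (by simp)
  exact hle.2 (by simp)

/-- Two edges at `v` whose other ends are joined by a walk avoiding `v` lie in the same block. -/
theorem IsBlockOf.adj_of_avoidReach {K X : VGraph V} (hX : IsBlockOf K X) {v a b : V}
    (hva : X.Adj v a) (hvb : K.Adj v b) (hab : AvoidReach K v a b) : X.Adj v b := by
  obtain ⟨Y, hYK, hY, hYa, hYb⟩ := hab.exists_walkBiconnected (hX.le.2 hva) hvb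
  exact (hX.le_of_adj hY hYK hva hYa).2 hYb

theorem IsBlockOf.adj_of_triangle {K X : VGraph V} (hX : IsBlockOf K X) {v a b : V}
    (hva : X.Adj v a) (hvb : K.Adj v b) (hab : K.Adj a b) : X.Adj v b ∧ X.Adj a b := by
  have h1 := hX.adj_of_avoidReach hva hvb (.single hab hva.ne.symm hvb.ne.symm)
  exact ⟨h1, hX.adj_of_mem hva.snd_mem h1.snd_mem hab⟩

/-- If a block `X` meets a connected subgraph `D` in `w` and a further vertex, then `X` contains an
edge of `D` at `w`. -/
theorem IsBlockOf.exists_adj_of_walkReach {K X D : VGraph V} (hX : IsBlockOf K X) (hD : D ≤ K)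
    {w w' : V} (hw : w ∈ X.verts) (hw' : w' ∈ X.verts) (hne : w' ≠ w) (h : WalkReach D w w') :
    ∃ c, X.Adj w c ∧ D.Adj w c := by
  obtain ⟨c, hwc, hc⟩ := h.exists_first_step hne
  obtain ⟨y, hy⟩ := hX.walkBiconnected.exists_adj hw hw' hne.symm
  refine ⟨c, hX.adj_of_avoidReach hy (hD.2 hwc) ?_, hwc⟩
  exact ((hX.walkBiconnected.avoid w y hy.snd_mem w' hw' hy.ne.symm hne).mono hX.le).trans
    (hc.mono hD).symm

/-- A property of edges that is passed on between any two edges of a biconnected graph with a common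
end holds for all edges if it holds for one. -/
theorem WalkBiconnected.forall_adj {X : VGraph V} (hX : WalkBiconnected X) {p : V → V → Prop}
    (hp : ∀ u v, p u v → p v u)
    (hstep : ∀ v a b, X.Adj v a → X.Adj v b → p v a → p v b) {x y : V} (hxy : X.Adj x y)
    (h : p x y) : ∀ u v, X.Adj u v → p u v := by
  have key : ∀ u, WalkReach X x u → ∀ v, X.Adj u v → p u v := by
    intro u hu
    induction hu with
    | refl => exact fun v hv => hstep x y v hxy hv h
    | @tail b c _ hbc ih => exact fun v hv => hstep c b v hbc.symm hv (hp _ _ (ih c hbc))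
  exact fun u v huv => key u (hX.reach x hxy.fst_mem u huv.fst_mem) v huv

end Blocks

/-! ### Induced paths and local embeddings into chordal graphs -/

section Chordal

variable {V W : Type*}

/-- In a chordal graph no sequence of vertices runs around an induced cycle of length at least
four. -/
theorem IsChordalGraph.not_inducedCycle {Q : VGraph W} (hQ : IsChordalGraph Q.coe) {n : ℕ}
    (hn : 4 ≤ n) (q : ℕ → W)
    (hinj : ∀ i j, i < j → j < n → q i ≠ q j)
    (hadj : ∀ i j, i < j → j < n → (Q.Adj (q i) (q j) ↔ j = i + 1 ∨ (i = 0 ∧ j + 1 = n))) :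
    False := by
  have hcyc : ∀ i j : Fin n, i < j →
      ((SimpleGraph.cycleGraph n).Adj i j ↔ j.1 = i.1 + 1 ∨ (i.1 = 0 ∧ j.1 + 1 = n)) := by
    intro i j hij
    rw [SimpleGraph.cycleGraph_adj']
    have h1 : (j - i).1 = j.1 - i.1 := Fin.sub_val_of_le hij.le
    have h2 : (i - j).1 = n - (j.1 - i.1) := by
      rw [Fin.val_sub]
      have := i.2
      have := j.2
      have hlt : i.1 < j.1 := hij
      rw [Nat.mod_eq_of_lt (by omega)]
      omega
    have := i.2
    have := j.2
    have hlt : i.1 < j.1 := hij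
    omega
  have hmem : ∀ i : Fin n, q i ∈ Q.verts := by
    intro i
    have := i.2
    by_cases hi : i.1 + 1 < n
    · exact ((hadj i (i + 1) (by omega) hi).2 (Or.inl rfl)).fst_mem
    · refine ((hadj (i - 1) i (by omega) (by omega)).2 (Or.inl (by omega))).snd_mem
  refine (hQ n hn).false ⟨⟨fun i => ⟨q i, hmem i⟩, ?_⟩, ?_⟩
  · intro i j h
    have h' : q i = q j := congrArg Subtype.val h
    rcases lt_trichotomy i j with hlt | rfl | hlt
    · exact absurd h' (hinj i j hlt j.2)
    · rfl
    · exact absurd h'.symm (hinj j i hlt i.2)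
  · intro i j
    change Q.Adj (q i) (q j) ↔ _
    rcases lt_trichotomy i j with hlt | rfl | hlt
    · rw [hcyc i j hlt, hadj i j hlt j.2]
    · exact ⟨fun h => absurd rfl h.ne, fun h => absurd rfl h.ne⟩
    · rw [SimpleGraph.adj_comm, hcyc j i hlt, ← hadj j i hlt i.2]
      exact ⟨fun h => h.symm, fun h => h.symm⟩

/-- In a chordal graph, a walk in which vertices at distance two along the walk are distinct and
nonadjacent is an induced path: a chord, or a repeated vertex, would close an induced cycle. -/
theorem IsChordalGraph.induced_of_locally_induced {Q : VGraph W} (hQ : IsChordalGraph Q.coe)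
    (q : ℕ → W) (n : ℕ) (hadj : ∀ i, i < n → Q.Adj (q i) (q (i + 1)))
    (htwo : ∀ i, i + 2 ≤ n → q i ≠ q (i + 2) ∧ ¬ Q.Adj (q i) (q (i + 2))) :
    ∀ k, 2 ≤ k → ∀ i, i + k ≤ n → q i ≠ q (i + k) ∧ ¬ Q.Adj (q i) (q (i + k)) := by
  intro k
  induction k using Nat.strong_induction_on with
  | _ k ih =>
    intro hk i hi
    rcases Nat.lt_or_ge k 3 with hk3 | hk3
    · obtain rfl : k = 2 := by omega
      exact htwo i hi
    · constructor
      · intro heq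
        have h1 := hadj (i + (k - 1)) (by omega)
        rw [show i + (k - 1) + 1 = i + k by omega, ← heq] at h1
        exact (ih (k - 1) (by omega) (by omega) i (by omega)).2 h1.symm
      · intro hchord
        refine hQ.not_inducedCycle (n := k + 1) (by omega) (fun j => q (i + j)) ?_ ?_
        · intro a b hab hb
          rcases Nat.lt_or_ge (b - a) 2 with h | h
          · obtain rfl : b = a + 1 := by omega
            exact (hadj (i + a) (by omega)).ne
          · rcases Nat.lt_or_ge (b - a) k with h' | h'
            · have := (ih (b - a) h' h (i + a) (by omega)).1
              rwa [show i + a + (b - a) = i + b by omega] at this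
            · obtain rfl : a = 0 := by omega
              obtain rfl : b = k := by omega
              exact hchord.ne
        · intro a b hab hb
          rcases Nat.lt_or_ge (b - a) 2 with h | h
          · obtain rfl : b = a + 1 := by omega
            exact ⟨fun _ => Or.inl rfl, fun _ => hadj (i + a) (by omega)⟩
          · rcases Nat.lt_or_ge (b - a) k with h' | h'
            · have := (ih (b - a) h' h (i + a) (by omega)).2
              rw [show i + a + (b - a) = i + b by omega] at this
              exact ⟨fun h => absurd h this, fun h => by omega⟩
            · obtain rfl : a = 0 := by omega
              obtain rfl : b = k := by omega
              exact ⟨fun _ => Or.inr ⟨rfl, rfl⟩, fun _ => hchord⟩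

/-- A shortest walk is an induced path. -/
theorem exists_induced_walk {F : SimpleGraph V} {x y : V} (h : F.Reachable x y) :
    ∃ p : ℕ → V, p 0 = x ∧ p (F.dist x y) = y ∧
      (∀ i, i < F.dist x y → F.Adj (p i) (p (i + 1))) ∧
      ∀ i, i + 2 ≤ F.dist x y → p i ≠ p (i + 2) ∧ ¬ F.Adj (p i) (p (i + 2)) := by
  obtain ⟨p, hp⟩ := h.exists_walk_length_eq_dist
  refine ⟨p.getVert, p.getVert_zero, ?_, ?_, ?_⟩
  · rw [← hp, p.getVert_length]
  · intro i hi
    exact p.adj_getVert_succ (hp ▸ hi)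
  · intro i hi
    have hshort : ∀ r : F.Walk (p.getVert i) (p.getVert (i + 2)), 2 ≤ r.length := by
      intro r
      have h1 := F.dist_le (((p.take i).append r).append (p.drop (i + 2)))
      simp only [SimpleGraph.Walk.length_append, SimpleGraph.Walk.take_length,
        SimpleGraph.Walk.drop_length] at h1
      omega
    constructor
    · intro heq
      have := hshort (SimpleGraph.Walk.nil.copy rfl heq)
      simp at this
    · intro hadj
      have := hshort hadj.toWalk
      simp at this

/-- A map from a connected graph `F` to a chordal graph `Q` that is an induced embedding around each
vertex is an induced embedding. It sends a shortest walk to a walk that is locally induced, so to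
an induced path. -/
theorem IsChordalGraph.embedding_of_local {F : SimpleGraph V} {Q : VGraph W}
    (hQ : IsChordalGraph Q.coe) (f : V → W) (hhom : ∀ x y, F.Adj x y → Q.Adj (f x) (f y))
    (hlocal : ∀ w x y, F.Adj w x → F.Adj w y → x ≠ y →
      f x ≠ f y ∧ (Q.Adj (f x) (f y) → F.Adj x y)) {x y : V} (h : F.Reachable x y)
    (hne : x ≠ y) : f x ≠ f y ∧ (Q.Adj (f x) (f y) → F.Adj x y) := by
  obtain ⟨p, hp0, hpn, hadj, htwo⟩ := exists_induced_walk h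
  have hpos := h.pos_dist_of_ne hne
  rcases Nat.lt_or_ge (F.dist x y) 2 with hlt | hge
  · have h1 : F.dist x y = 1 := by omega
    have := hadj 0 hpos
    rw [h1] at hpn
    rw [hp0, zero_add, hpn] at this
    exact ⟨(hhom _ _ this).ne, fun _ => this⟩
  · have key := hQ.induced_of_locally_induced (fun i => f (p i)) (F.dist x y)
      (fun i hi => hhom _ _ (hadj i hi)) ?_ (F.dist x y) hge 0 (by omega)
    · simp only [zero_add, hp0, hpn] at key
      exact ⟨key.1, fun h => absurd h key.2⟩
    · intro i hi
      have h2 := htwo i hi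
      have h3 := hlocal (p (i + 1)) (p i) (p (i + 2)) (hadj i (by omega)).symm
        (hadj (i + 1) (by omega)) h2.1
      exact ⟨h3.1, fun h => h2.2 (h3.2 h)⟩

/-- The graph that a subgraph `X` induces on the neighbors of `w`. -/
def neighborGraph (X : VGraph V) (w : V) : SimpleGraph V where
  Adj x y := X.Adj x y ∧ X.Adj w x ∧ X.Adj w y
  symm := ⟨fun _ _ h => ⟨h.1.symm, h.2.2, h.2.1⟩⟩
  loopless := ⟨fun _ h => h.1.ne rfl⟩

/-- In a chordal graph, neighbors of `w` that are joined by a walk avoiding `w` are joined by a walk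
within the neighborhood of `w`: a shortest walk avoiding `w` that leaves the neighborhood at its
first step would, preceded by `w`, be an induced path from `w`. -/
theorem IsChordalGraph.neighborGraph_reachable {Q : VGraph W} (hQ : IsChordalGraph Q.coe)
    {w a b : W} (ha : Q.Adj w a) (hb : Q.Adj w b) (hab : AvoidReach Q w a b) :
    (neighborGraph Q w).Reachable a b := by
  let R : SimpleGraph W :=
    { Adj := fun x y => Q.Adj x y ∧ x ≠ w ∧ y ≠ w
      symm := ⟨fun _ _ h => ⟨h.1.symm, h.2.2, h.2.1⟩⟩
      loopless := ⟨fun _ h => h.1.ne rfl⟩ }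
  have hR : R.Reachable a b := (SimpleGraph.reachable_iff_reflTransGen a b).2 hab
  have key : ∀ n a, R.dist a b ≤ n → R.Reachable a b → Q.Adj w a →
      (neighborGraph Q w).Reachable a b := by
    intro n
    induction n with
    | zero =>
      intro a hn hR _
      rw [Nat.le_zero, hR.dist_eq_zero_iff] at hn
      rw [hn]
    | succ n ih =>
      intro a hn hR ha
      rcases hn.lt_or_eq with hlt | hn
      · exact ih a (by omega) hR ha
      obtain ⟨p, hp0, hpn, hadj, htwo⟩ := exists_induced_walk hR
      rw [hn] at hpn hadj htwo
      have h01 : R.Adj a (p 1) := by simpa [hp0] using hadj 0 (by omega)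
      have hp1 : Q.Adj w (p 1) := by
        by_contra hcon
        rcases Nat.eq_zero_or_pos n with rfl | hpos
        · exact hcon (by rw [zero_add] at hpn; rwa [hpn])
        · have := hQ.induced_of_locally_induced
            (fun i => match i with | 0 => w | i + 1 => p i) (n + 2) ?_ ?_ (n + 2) (by omega) 0
            (by omega)
          · refine this.2 ?_
            change Q.Adj w (p (0 + (n + 1)))
            rwa [zero_add, hpn]
          · rintro (_ | i) hi
            · simpa [hp0] using ha
            · exact (hadj i (by omega)).1
          · rintro (_ | i) hi
            · exact ⟨h01.2.2.symm, hcon⟩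
            · have h2 := htwo i (by omega)
              have h3 := hadj i (by omega)
              have h4 := hadj (i + 1) (by omega)
              exact ⟨h2.1, fun h => h2.2 ⟨h, h3.2.1, h4.2.2⟩⟩
      have hR1 : R.Reachable (p 1) b := h01.reachable.symm.trans hR
      have hge : R.dist (p 1) b ≤ n := by
        have hwalk : ∀ k, k ≤ n → ∃ r : R.Walk (p 1) (p (1 + k)), r.length = k := by
          intro k
          induction k with
          | zero => exact fun _ => ⟨.nil, rfl⟩
          | succ k ihk =>
            intro hk
            obtain ⟨r, hr⟩ := ihk (by omega)
            exact ⟨r.concat (hadj (1 + k) (by omega)), by simp [hr]⟩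
        obtain ⟨r, hr⟩ := hwalk n le_rfl
        rw [← hr]
        exact R.dist_le (r.copy rfl (by rw [add_comm, hpn])) |>.trans (by simp)
      have hstep : (neighborGraph Q w).Adj a (p 1) := ⟨h01.1, ha, hp1⟩
      exact hstep.reachable.trans (ih (p 1) hge hR1 hp1)
  exact key _ a le_rfl hR ha

end Chordal

/-! ### Connected separators arranged along a forest -/

section Forest

variable {τ : Type*}

/-- Every edge of a forest is a bridge. -/
theorem isAcyclic_not_reach {T : VGraph τ} (hT : T.coe.IsAcyclic) {u a : τ} (h : T.Adj u a) :
    ¬ Relation.ReflTransGen (fun x y => T.Adj x y ∧ s(x, y) ≠ s(u, a)) u a := by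
  intro hr
  have hb := SimpleGraph.isAcyclic_iff_forall_adj_isBridge.1 hT
    (v := ⟨u, h.fst_mem⟩) (w := ⟨a, h.snd_mem⟩) h
  rw [SimpleGraph.isBridge_iff] at hb
  apply hb
  rw [SimpleGraph.reachable_iff_reflTransGen]
  have key : ∀ z, Relation.ReflTransGen (fun x y => T.Adj x y ∧ s(x, y) ≠ s(u, a)) u z →
      ∀ hz : z ∈ T.verts, Relation.ReflTransGen
        (T.coe.deleteEdges {s(⟨u, h.fst_mem⟩, ⟨a, h.snd_mem⟩)}).Adj ⟨u, h.fst_mem⟩ ⟨z, hz⟩ := by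
    intro z hz
    induction hz with
    | refl => exact fun _ => .refl
    | @tail b c _ hbc ih =>
      intro hc
      refine (ih hbc.1.fst_mem).tail ?_
      rw [SimpleGraph.deleteEdges_adj]
      refine ⟨hbc.1, fun hmem => hbc.2 ?_⟩
      have := congrArg (Sym2.map Subtype.val) (Set.mem_singleton_iff.1 hmem)
      simpa using this
  exact key a hr h.snd_mem

/-- In a forest, let `A` be a connected set of vertices. A walk outside `A` that starts and ends
next to `A` starts and ends in the same vertex, and this vertex has only one neighbor in `A`. -/
theorem isAcyclic_unique_attachment {T : VGraph τ} (hT : T.coe.IsAcyclic) {A : Set τ}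
    (hA : ∀ a ∈ A, ∀ a' ∈ A, Relation.ReflTransGen (fun x y => T.Adj x y ∧ x ∈ A ∧ y ∈ A) a a')
    {u w a a' : τ} (ha : a ∈ A) (ha' : a' ∈ A) (hu : u ∉ A) (hw : w ∉ A) (hua : T.Adj u a)
    (hwa : T.Adj w a')
    (huw : Relation.ReflTransGen (fun x y => T.Adj x y ∧ x ∉ A ∧ y ∉ A) u w) :
    u = w ∧ a = a' := by
  by_contra hne
  refine isAcyclic_not_reach hT hua ((Relation.ReflTransGen.mono ?_ _ _ huw).trans
    (Relation.ReflTransGen.head ⟨hwa, ?_⟩ (Relation.ReflTransGen.mono ?_ _ _ (hA a' ha' a ha))))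
  · rintro x y ⟨h, hx, hy⟩
    refine ⟨h, fun heq => ?_⟩
    rcases Sym2.eq_iff.1 heq with ⟨-, rfl⟩ | ⟨rfl, -⟩
    exacts [hy ha, hx ha]
  · intro heq
    rcases Sym2.eq_iff.1 heq with ⟨rfl, rfl⟩ | ⟨rfl, -⟩
    exacts [hne ⟨rfl, rfl⟩, hw ha]
  · rintro x y ⟨h, hx, hy⟩
    refine ⟨h, fun heq => ?_⟩
    rcases Sym2.eq_iff.1 heq with ⟨rfl, -⟩ | ⟨-, rfl⟩
    exacts [hu hx, hu hy]

end Forest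

section Amalgam

variable {V : Type u}

/-- Two graphs `Gr false` and `Gr true` that meet exactly in `S` and both induce `D` on `S`. The
index makes the two sides interchangeable. -/
structure IsAmalgam (Gr : Bool → VGraph V) (S : Set V) (D : VGraph V) : Prop where
  subset : ∀ i, S ⊆ (Gr i).verts
  mem_of_ne : ∀ i j, i ≠ j → ∀ x ∈ (Gr i).verts, x ∈ (Gr j).verts → x ∈ S
  induce_eq : ∀ i, (Gr i).induce S = D

/-- The union of the two sides. -/
abbrev amalgamSum (Gr : Bool → VGraph V) : VGraph V := boundariedSum (Gr false) (Gr true)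

theorem amalgamSum_adj {Gr : Bool → VGraph V} {x y : V} :
    (amalgamSum Gr).Adj x y ↔ ∃ i, (Gr i).Adj x y := by
  simp [boundariedSum]

theorem mem_amalgamSum {Gr : Bool → VGraph V} {x : V} :
    x ∈ (amalgamSum Gr).verts ↔ ∃ i, x ∈ (Gr i).verts := by
  simp [boundariedSum]

theorem le_amalgamSum (Gr : Bool → VGraph V) (i : Bool) : Gr i ≤ amalgamSum Gr := by
  cases i
  exacts [le_sup_left, le_sup_right]

namespace IsAmalgam

variable {Gr : Bool → VGraph V} {S : Set V} {D : VGraph V}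

theorem verts_eq (h : IsAmalgam Gr S D) : D.verts = S := by
  rw [← h.induce_eq false]; rfl

theorem adj_iff (h : IsAmalgam Gr S D) (i : Bool) {x y : V} :
    D.Adj x y ↔ x ∈ S ∧ y ∈ S ∧ (Gr i).Adj x y := by
  rw [← h.induce_eq i]; rfl

theorem le (h : IsAmalgam Gr S D) (i : Bool) : D ≤ Gr i := by
  refine ⟨by rw [h.verts_eq]; exact h.subset i, fun x y hxy => ((h.adj_iff i).1 hxy).2.2⟩

theorem le_sum (h : IsAmalgam Gr S D) : D ≤ amalgamSum Gr :=
  (h.le false).trans (le_amalgamSum Gr false)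

theorem adj_of_ne (h : IsAmalgam Gr S D) {i j : Bool} (hij : i ≠ j) {x y : V}
    (hx : x ∈ (Gr i).verts) (hy : y ∈ (Gr i).verts) (hxy : (Gr j).Adj x y) : D.Adj x y :=
  (h.adj_iff j).2 ⟨h.mem_of_ne i j hij x hx hxy.fst_mem, h.mem_of_ne i j hij y hy hxy.snd_mem, hxy⟩

theorem adj_of_mem (h : IsAmalgam Gr S D) {x y : V} (hx : x ∈ S) (hy : y ∈ S)
    (hxy : (amalgamSum Gr).Adj x y) : D.Adj x y := by
  obtain ⟨i, hi⟩ := amalgamSum_adj.1 hxy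
  exact (h.adj_iff i).2 ⟨hx, hy, hi⟩

/-- Each side is an induced subgraph of the union. -/
theorem adj_of_mem_verts (h : IsAmalgam Gr S D) {i : Bool} {x y : V} (hx : x ∈ (Gr i).verts)
    (hy : y ∈ (Gr i).verts) (hxy : (amalgamSum Gr).Adj x y) : (Gr i).Adj x y := by
  obtain ⟨j, hj⟩ := amalgamSum_adj.1 hxy
  by_cases hij : i = j
  · rwa [hij]
  · exact (h.le i).2 (h.adj_of_ne hij hx hy hj)

theorem induce_sum (h : IsAmalgam Gr S D) : (amalgamSum Gr).induce S = D := by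
  refine SimpleGraph.Subgraph.ext h.verts_eq.symm ?_
  funext x y
  refine propext ⟨fun hxy => h.adj_of_mem hxy.1 hxy.2.1 hxy.2.2, fun hxy => ?_⟩
  have := (h.adj_iff false).1 hxy
  exact ⟨this.1, this.2.1, (le_amalgamSum Gr false).2 this.2.2⟩

/-- Every triangle of the union lies in one of the two sides. -/
theorem exists_triangle (h : IsAmalgam Gr S D) {x y z : V} (hxy : (amalgamSum Gr).Adj x y)
    (hxz : (amalgamSum Gr).Adj x z) (hyz : (amalgamSum Gr).Adj y z) :
    ∃ i, (Gr i).Adj x y ∧ (Gr i).Adj x z ∧ (Gr i).Adj y z := by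
  have key : ∀ {x y z : V}, x ∉ S → (amalgamSum Gr).Adj x y → (amalgamSum Gr).Adj x z →
      (amalgamSum Gr).Adj y z → ∃ i, (Gr i).Adj x y ∧ (Gr i).Adj x z ∧ (Gr i).Adj y z := by
    intro x y z hx hxy hxz hyz
    obtain ⟨i, hi⟩ := amalgamSum_adj.1 hxy
    obtain ⟨j, hj⟩ := amalgamSum_adj.1 hxz
    obtain rfl : i = j := by
      by_contra hij
      exact hx (h.mem_of_ne i j hij x hi.fst_mem hj.fst_mem)
    exact ⟨i, hi, hj, h.adj_of_mem_verts hi.snd_mem hj.snd_mem hyz⟩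
  by_cases hx : x ∈ S
  · by_cases hy : y ∈ S
    · by_cases hz : z ∈ S
      · exact ⟨false, (h.le _).2 (h.adj_of_mem hx hy hxy), (h.le _).2 (h.adj_of_mem hx hz hxz),
          (h.le _).2 (h.adj_of_mem hy hz hyz)⟩
      · obtain ⟨i, h1, h2, h3⟩ := key hz hxz.symm hyz.symm hxy
        exact ⟨i, h3, h1.symm, h2.symm⟩
    · obtain ⟨i, h1, h2, h3⟩ := key hy hxy.symm hyz hxz
      exact ⟨i, h1.symm, h3, h2⟩
  · exact key hx hxy hxz hyz

end IsAmalgam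

theorem setOf_walkReach_mem_componentSets {G : VGraph V} {x : V} (hx : x ∈ G.verts) :
    {y | WalkReach G x y} ∈ componentSets G := by
  refine ⟨G.coe.connectedComponentMk ⟨x, hx⟩, ?_⟩
  ext y
  constructor
  · intro hy
    refine ⟨⟨y, WalkReach.right_mem hy hx⟩, ?_, rfl⟩
    exact SimpleGraph.ConnectedComponent.sound ((walkReach_iff_reachable _ ⟨x, hx⟩).2 hy.symm)
  · rintro ⟨y, hy, rfl⟩
    exact ((walkReach_iff_reachable y ⟨x, hx⟩).1 (SimpleGraph.ConnectedComponent.exact hy)).symm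

/-- The vertex of the auxiliary forest for the component of `x` in the side `i`. -/
def sideBag (Gr : Bool → VGraph V) (i : Bool) (x : V) : (Bool × Set V) ⊕ Set V :=
  Sum.inl (i, {y | WalkReach (Gr i) x y})

/-- The vertex of the auxiliary forest for the component of `x` in `D`. -/
def boundaryBag (D : VGraph V) (x : V) : (Bool × Set V) ⊕ Set V :=
  Sum.inr {y | WalkReach D x y}

/-- The components containing `x`, as vertices of the auxiliary forest: one, if `x ∉ S`, otherwise
the component in `D` and one on either side. -/
def bags (Gr : Bool → VGraph V) (S : Set V) (D : VGraph V) (x : V) :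
    Set ((Bool × Set V) ⊕ Set V) :=
  {Z | (∃ i, x ∈ (Gr i).verts ∧ Z = sideBag Gr i x) ∨ (x ∈ S ∧ Z = boundaryBag D x)}

/-- Two edges of one side at `v` whose other ends are joined by a walk of this side avoiding `v`. -/
def SideLink (Gr : Bool → VGraph V) (v c c' : V) : Prop :=
  ∃ i, (Gr i).Adj v c ∧ (Gr i).Adj v c' ∧ AvoidReach (Gr i) v c c'

theorem setOf_walkReach_congr {G : VGraph V} {x y : V} (h : WalkReach G x y) :
    {z | WalkReach G x z} = {z | WalkReach G y z} :=
  Set.ext fun _ => ⟨fun h' => h.symm.trans h', fun h' => h.trans h'⟩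

theorem sideBag_congr {Gr : Bool → VGraph V} {i : Bool} {x y : V} (h : WalkReach (Gr i) x y) :
    sideBag Gr i x = sideBag Gr i y := by
  rw [sideBag, sideBag, setOf_walkReach_congr h]

theorem boundaryBag_congr {D : VGraph V} {x y : V} (h : WalkReach D x y) :
    boundaryBag D x = boundaryBag D y := by
  rw [boundaryBag, boundaryBag, setOf_walkReach_congr h]

theorem walkReach_of_boundaryBag_eq {D : VGraph V} {x y : V}
    (h : boundaryBag D x = boundaryBag D y) : WalkReach D x y := by
  have h1 : {z | WalkReach D x z} = {z | WalkReach D y z} := Sum.inr_injective h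
  have h2 : y ∈ {z | WalkReach D y z} := Relation.ReflTransGen.refl
  rwa [← h1] at h2

theorem AvoidReach.walkReach {G : VGraph V} {v x y : V} (h : AvoidReach G v x y) :
    WalkReach G x y :=
  Relation.ReflTransGen.mono (fun _ _ h => h.1) _ _ h

namespace IsAmalgam

variable {Gr : Bool → VGraph V} {S : Set V} {D : VGraph V}

theorem auxSum_adj (h : IsAmalgam Gr S D) (i : Bool) {x : V} (hx : x ∈ S) :
    (auxSum (Gr false) (Gr true) S).Adj (boundaryBag D x) (sideBag Gr i x) := by
  have hmem : {y | WalkReach D x y} ∈ componentSets ((Gr i).induce S) := by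
    rw [h.induce_eq i]
    exact setOf_walkReach_mem_componentSets (h.verts_eq ▸ hx)
  have : (auxGraph i (Gr i) S).Adj (boundaryBag D x) (sideBag Gr i x) :=
    ⟨_, setOf_walkReach_mem_componentSets (h.subset i hx), _, hmem,
      fun y hy => WalkReach.mono (h.le i) hy, Or.inr ⟨rfl, rfl⟩⟩
  cases i
  exacts [Or.inl this, Or.inr this]

theorem bags_connected (h : IsAmalgam Gr S D) (v : V) :
    ∀ a ∈ bags Gr S D v, ∀ a' ∈ bags Gr S D v,
      Relation.ReflTransGen (fun x y => (auxSum (Gr false) (Gr true) S).Adj x y ∧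
        x ∈ bags Gr S D v ∧ y ∈ bags Gr S D v) a a' := by
  have hedge : v ∈ S → ∀ a ∈ bags Gr S D v,
      Relation.ReflTransGen (fun x y => (auxSum (Gr false) (Gr true) S).Adj x y ∧
        x ∈ bags Gr S D v ∧ y ∈ bags Gr S D v) (boundaryBag D v) a ∧
      Relation.ReflTransGen (fun x y => (auxSum (Gr false) (Gr true) S).Adj x y ∧
        x ∈ bags Gr S D v ∧ y ∈ bags Gr S D v) a (boundaryBag D v) := by
    rintro hv a (⟨i, hi, rfl⟩ | ⟨-, rfl⟩)
    · exact ⟨.single ⟨h.auxSum_adj i hv, Or.inr ⟨hv, rfl⟩, Or.inl ⟨i, hi, rfl⟩⟩,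
        .single ⟨(h.auxSum_adj i hv).symm, Or.inl ⟨i, hi, rfl⟩, Or.inr ⟨hv, rfl⟩⟩⟩
    · exact ⟨.refl, .refl⟩
  intro a ha a' ha'
  by_cases hv : v ∈ S
  · exact (hedge hv a ha).2.trans (hedge hv a' ha').1
  · rcases ha with ⟨i, hi, rfl⟩ | ⟨hv', -⟩
    · rcases ha' with ⟨j, hj, rfl⟩ | ⟨hv', -⟩
      · by_cases hij : i = j
        · rw [hij]
        · exact absurd (h.mem_of_ne i j hij v hi hj) hv
      · exact absurd hv' hv
    · exact absurd hv' hv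

/-- If the components of the two sides, glued along the components of `D`, form a forest, then two
neighbors of `v` that are joined by a walk of the union avoiding `v` are linked through edges at
`v` on alternating sides. An excursion of the walk out of the components of `v` returns through
the component of `D` through which it left, and can be replaced by a walk there. -/
theorem sideLink_of_avoidReach (h : IsAmalgam Gr S D)
    (hT : (auxSum (Gr false) (Gr true) S).coe.IsAcyclic) {v a b : V}
    (ha : (amalgamSum Gr).Adj v a) (hb : (amalgamSum Gr).Adj v b)
    (hab : AvoidReach (amalgamSum Gr) v a b) :
    Relation.ReflTransGen (SideLink Gr v) a b := by
  set A := bags Gr S D v with hA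
  -- `Near i x`: the vertex `x` is reached from `v` within the side `i`, starting with an edge
  -- linked to `a`.
  let Near : Bool → V → Prop := fun i x =>
    ∃ c, (Gr i).Adj v c ∧ Relation.ReflTransGen (SideLink Gr v) a c ∧ AvoidReach (Gr i) v c x
  let Out := Relation.ReflTransGen fun x y =>
    (auxSum (Gr false) (Gr true) S).Adj x y ∧ x ∉ A ∧ y ∉ A
  have near_mem : ∀ {i x}, Near i x → x ∈ (Gr i).verts ∧ v ∈ (Gr i).verts ∧
      sideBag Gr i x = sideBag Gr i v := by
    rintro i x ⟨c, hc, -, hcx⟩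
    exact ⟨hcx.right_mem hc.snd_mem, hc.fst_mem,
      (sideBag_congr (.head hc hcx.walkReach)).symm⟩
  have near_bag : ∀ {i x}, Near i x → sideBag Gr i x ∈ A := fun hx =>
    Or.inl ⟨_, (near_mem hx).2.1, (near_mem hx).2.2⟩
  have near_step : ∀ {i x y}, Near i x → (Gr i).Adj x y → x ≠ v → y ≠ v → Near i y := by
    rintro i x y ⟨c, hc, hac, hcx⟩ hxy hx hy
    exact ⟨c, hc, hac, hcx.tail ⟨hxy, hx, hy⟩⟩
  have boundary_mem : ∀ {x}, boundaryBag D x ∈ A → v ∈ S ∧ WalkReach D v x := by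
    rintro x (⟨i, -, hi⟩ | ⟨hv, hx⟩)
    · simp [boundaryBag, sideBag] at hi
    · exact ⟨hv, walkReach_of_boundaryBag_eq hx.symm⟩
  have side_mem : ∀ {x}, boundaryBag D x ∈ A → ∀ i, sideBag Gr i x ∈ A := by
    intro x hx i
    obtain ⟨hv, hvx⟩ := boundary_mem hx
    exact Or.inl ⟨i, h.subset i hv, (sideBag_congr (hvx.mono (h.le i))).symm⟩
  have near_congr : ∀ {i x y}, y ∈ S → boundaryBag D y ∉ A → boundaryBag D y = boundaryBag D x →
      Near i y → Near i x := by
    rintro i x y hy hyA hyx ⟨c, hc, hac, hcy⟩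
    refine ⟨c, hc, hac, hcy.trans ?_⟩
    refine ((walkReach_of_boundaryBag_eq hyx).avoid fun hyv => hyA ?_).mono (h.le i)
    have hv : v ∈ S := h.verts_eq ▸ hyv.right_mem (h.verts_eq ▸ hy)
    exact Or.inr ⟨hv, boundaryBag_congr hyv⟩
  -- An excursion that comes back to the components of `v` does so where it started.
  have merge : ∀ {i j x y Z}, y ∈ S → boundaryBag D y ∉ A → Near i y → Out (boundaryBag D y) Z →
      Z ∈ bags Gr S D x → Z ∉ A → x ∈ (Gr j).verts → sideBag Gr j x ∈ A → Near i x := by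
    intro i j x y Z hy hyA hiy hout hZ hZA hxj hxA
    have hxS : x ∈ S := by
      rcases hZ with ⟨k, hk, rfl⟩ | ⟨hx, -⟩
      · refine h.mem_of_ne k j ?_ x hk hxj
        rintro rfl
        exact hZA hxA
      · exact hx
    have hxD : boundaryBag D x ∉ A := by
      intro hcon
      rcases hZ with ⟨k, -, rfl⟩ | ⟨-, rfl⟩
      exacts [hZA (side_mem hcon k), hZA hcon]
    have hout' : Out (boundaryBag D y) (boundaryBag D x) := by
      rcases hZ with ⟨k, -, rfl⟩ | ⟨-, rfl⟩
      · exact hout.tail ⟨(h.auxSum_adj k hxS).symm, hZA, hxD⟩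
      · exact hout
    have huniq := isAcyclic_unique_attachment hT (h.bags_connected v) (near_bag hiy) hxA hyA hxD
      (h.auxSum_adj i hy) (h.auxSum_adj j hxS) hout'
    exact near_congr hy hyA huniq.1 hiy
  let Inv : V → Prop := fun x => (∃ i, Near i x) ∨
    ∃ y i Z, y ∈ S ∧ boundaryBag D y ∉ A ∧ Near i y ∧ Out (boundaryBag D y) Z ∧
      Z ∈ bags Gr S D x ∧ Z ∉ A
  have step_near : ∀ {i j x y}, Near i x → (Gr j).Adj x y → x ≠ v → y ≠ v → Inv y := by
    intro i j x y hix hxy hx hy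
    by_cases hij : i = j
    · subst hij
      exact Or.inl ⟨i, near_step hix hxy hx hy⟩
    have hxS : x ∈ S := h.mem_of_ne i j hij x (near_mem hix).1 hxy.fst_mem
    by_cases hxD : boundaryBag D x ∈ A
    · -- The walk changes sides within the component of `v` in `D`, where an edge at `v` leads
      -- towards `x`.
      obtain ⟨hv, hvx⟩ := boundary_mem hxD
      obtain ⟨c', hc', hcx'⟩ := hvx.exists_first_step hx
      obtain ⟨c, hc, hac, hcx⟩ := hix
      refine Or.inl ⟨j, near_step ⟨c', (h.le j).2 hc', hac.tail ?_, hcx'.mono (h.le j)⟩ hxy hx hy⟩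
      exact ⟨i, hc, (h.le i).2 hc', hcx.trans (hcx'.mono (h.le i)).symm⟩
    · have hjA : sideBag Gr j x ∉ A := by
        intro hjA
        have := (isAcyclic_unique_attachment hT (h.bags_connected v) (near_bag hix) hjA hxD hxD
          (h.auxSum_adj i hxS) (h.auxSum_adj j hxS) .refl).2
        simp only [sideBag, Sum.inl.injEq, Prod.mk.injEq] at this
        exact hij this.1
      exact Or.inr ⟨x, i, sideBag Gr j x, hxS, hxD, hix,
        .single ⟨h.auxSum_adj j hxS, hxD, hjA⟩,
        Or.inl ⟨j, hxy.snd_mem, sideBag_congr (.single hxy)⟩, hjA⟩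
  have step : ∀ {x y}, Inv x → (amalgamSum Gr).Adj x y → x ≠ v → y ≠ v → Inv y := by
    intro x y hx hxy hxv hyv
    obtain ⟨j, hj⟩ := amalgamSum_adj.1 hxy
    rcases hx with ⟨i, hi⟩ | ⟨y', i, Z, hy', hyA, hiy, hout, hZ, hZA⟩
    · exact step_near hi hj hxv hyv
    by_cases hjA : sideBag Gr j x ∈ A
    · exact step_near (merge hy' hyA hiy hout hZ hZA hj.fst_mem hjA) hj hxv hyv
    have hxD : boundaryBag D x ∉ A := fun hcon => hjA (side_mem hcon j)
    refine Or.inr ⟨y', i, sideBag Gr j x, hy', hyA, hiy, hout.trans ?_,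
      Or.inl ⟨j, hj.snd_mem, sideBag_congr (.single hj)⟩, hjA⟩
    rcases hZ with ⟨k, hk, rfl⟩ | ⟨hxS, rfl⟩
    · by_cases hkj : k = j
      · rw [hkj]
      · have hxS := h.mem_of_ne k j hkj x hk hj.fst_mem
        exact (Relation.ReflTransGen.single ⟨(h.auxSum_adj k hxS).symm, hZA, hxD⟩).tail
          ⟨h.auxSum_adj j hxS, hxD, hjA⟩
    · exact .single ⟨h.auxSum_adj j hxS, hxD, hjA⟩
  have hInv : ∀ x, AvoidReach (amalgamSum Gr) v a x → Inv x := by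
    intro x hx
    induction hx with
    | refl =>
      obtain ⟨i, hi⟩ := amalgamSum_adj.1 ha
      exact Or.inl ⟨i, a, hi, .refl, .refl⟩
    | tail _ hxy ih => exact step ih hxy.1 hxy.2.1 hxy.2.2
  obtain ⟨j, hj⟩ := amalgamSum_adj.1 hb
  have hnear : ∃ i, Near i b := by
    rcases hInv b hab with hb | ⟨y, i, Z, hy, hyA, hiy, hout, hZ, hZA⟩
    · exact hb
    · exact ⟨i, merge hy hyA hiy hout hZ hZA hj.snd_mem
        (Or.inl ⟨j, hj.fst_mem, (sideBag_congr (.single hj)).symm⟩)⟩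
  obtain ⟨i, hi⟩ := hnear
  have hib : (Gr i).Adj v b := h.adj_of_mem_verts (near_mem hi).2.1 (near_mem hi).1 hb
  obtain ⟨c, hc, hac, hcb⟩ := hi
  exact hac.tail ⟨i, hc, hib, hcb⟩

end IsAmalgam

end Amalgam

/-! ### Blocks of the union that contain a boundary edge -/

section Model

variable {V : Type u} {Λ : Type*}

/-- The non-trivial blocks of `D`. -/
def nontrivialBlocks (D : VGraph V) : Set (VGraph V) :=
  {B | IsBlockOf D B ∧ B.verts.Nontrivial}

theorem exists_nontrivialBlock {D : VGraph V} (hD : D.verts.Finite) {x y : V} (h : D.Adj x y) :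
    ∃ B ∈ nontrivialBlocks D, B.Adj x y := by
  obtain ⟨B, hB, hxy⟩ := exists_block_of_adj hD h
  exact ⟨B, ⟨hB, x, hxy.fst_mem, y, hxy.snd_mem, hxy.ne⟩, hxy⟩

theorem exists_adj_of_mem_nontrivialBlocks {D B : VGraph V} (hB : B ∈ nontrivialBlocks D) :
    ∃ x y, B.Adj x y := by
  obtain ⟨x, hx, y, hy, hne⟩ := hB.2
  obtain ⟨c, hc⟩ := hB.1.walkBiconnected.exists_adj hx hy hne
  exact ⟨x, c, hc⟩

/-- A model of the blocks of a graph `G` that contain a non-trivial block `B` of `D`: a graph `Q B`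
whose vertices are labels, into which these blocks embed through their labels. By `complete`, only
at the vertices that are incident with an edge of `D` in the block may the model have further
neighbors. -/
structure SideModel (G : VGraph V) (S : Set V) (D : VGraph V) (L : V → Λ)
    (Q : VGraph V → VGraph Λ) : Prop where
  finite : G.verts.Finite
  chordal_side : ∀ Y, IsSBlock G S Y → IsChordalGraph Y.coe
  label_mem : ∀ Y, IsSBlock G S Y → ∀ B ∈ nontrivialBlocks D, B ≤ Y →
    ∀ x ∈ Y.verts, L x ∈ (Q B).verts
  label_injOn : ∀ Y, IsSBlock G S Y → ∀ B ∈ nontrivialBlocks D, B ≤ Y → Set.InjOn L Y.verts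
  adj_iff : ∀ Y, IsSBlock G S Y → ∀ B ∈ nontrivialBlocks D, B ≤ Y →
    ∀ x ∈ Y.verts, ∀ y ∈ Y.verts, (Y.Adj x y ↔ (Q B).Adj (L x) (L y))
  coincidence : ∀ Y, IsSBlock G S Y → ∀ B ∈ nontrivialBlocks D, B ≤ Y →
    ∀ B' ∈ nontrivialBlocks D, B' ≤ Y → Q B' = Q B
  complete : ∀ Y, IsSBlock G S Y → ∀ B ∈ nontrivialBlocks D, B ≤ Y →
    ∀ w ∈ Y.verts, (∀ c, Y.Adj w c → ¬ D.Adj w c) →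
      ∀ l, (Q B).Adj (L w) l → ∃ y, Y.Adj w y ∧ L y = l

/-- A model of both sides of an amalgam by chordal biconnected graphs. At an edge `wc` of `B`, the
common neighbors of `w` and `c` in the model come from the two sides (`extend`), and those outside
`S` from different sides are kept apart (`separated`). -/
structure BoundaryModel (Gr : Bool → VGraph V) (S : Set V) (D : VGraph V) (L : V → Λ)
    (Q : VGraph V → VGraph Λ) : Prop where
  side : ∀ i, SideModel (Gr i) S D L Q
  biconnected : ∀ B ∈ nontrivialBlocks D, WalkBiconnected (Q B)
  chordal : ∀ B ∈ nontrivialBlocks D, IsChordalGraph (Q B).coe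
  separated : ∀ B ∈ nontrivialBlocks D, ∀ i j, i ≠ j → ∀ w c x y, B.Adj w c →
    (Gr i).Adj w x → (Gr i).Adj c x → (Gr j).Adj w y → (Gr j).Adj c y → x ∉ S → y ∉ S →
      L x ≠ L y ∧ ¬ (Q B).Adj (L x) (L y)
  extend : ∀ B ∈ nontrivialBlocks D, ∀ w c l, B.Adj w c → (Q B).Adj (L w) l → (Q B).Adj (L c) l →
    ∃ y i, (Gr i).Adj w y ∧ (Gr i).Adj c y ∧ L y = l

variable {Gr : Bool → VGraph V} {S : Set V} {D : VGraph V} {L : V → Λ} {Q : VGraph V → VGraph Λ}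

theorem IsAmalgam.isSBlock_iff (h : IsAmalgam Gr S D) {i : Bool} {Y : VGraph V} :
    IsSBlock (Gr i) S Y ↔ IsBlockOf (Gr i) Y ∧ ∃ u v, Y.Adj u v ∧ D.Adj u v := by
  rw [IsSBlock, h.induce_eq i]

theorem IsAmalgam.isSBlock_sum_iff (h : IsAmalgam Gr S D) {Y : VGraph V} :
    IsSBlock (amalgamSum Gr) S Y ↔
      IsBlockOf (amalgamSum Gr) Y ∧ ∃ u v, Y.Adj u v ∧ D.Adj u v := by
  rw [IsSBlock, h.induce_sum]

theorem IsAmalgam.isSBlock_of_le (h : IsAmalgam Gr S D) {i : Bool} {Y B : VGraph V}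
    (hY : IsBlockOf (Gr i) Y) (hB : B ∈ nontrivialBlocks D) (hBY : B ≤ Y) :
    IsSBlock (Gr i) S Y := by
  obtain ⟨x, y, hxy⟩ := exists_adj_of_mem_nontrivialBlocks hB
  exact h.isSBlock_iff.2 ⟨hY, x, y, hBY.2 hxy, hB.1.le.2 hxy⟩

theorem IsAmalgam.le_of_adj (h : IsAmalgam Gr S D) {i : Bool} {Y B : VGraph V}
    (hY : IsBlockOf (Gr i) Y) (hB : B ∈ nontrivialBlocks D) {x y : V} (hxy : B.Adj x y)
    (hYxy : Y.Adj x y) : B ≤ Y :=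
  hY.le_of_adj hB.1.walkBiconnected (hB.1.le.trans (h.le i)) hYxy hxy

theorem IsAmalgam.verts_finite (h : IsAmalgam Gr S D) (hfin : ∀ i, (Gr i).verts.Finite) :
    D.verts.Finite :=
  (hfin false).subset (h.le false).1

/-- An edge lies, in each side that contains it, in a block with the model `q`. -/
def HasModelAt (Gr : Bool → VGraph V) (S : Set V) (D : VGraph V) (Q : VGraph V → VGraph Λ)
    (q : VGraph Λ) (u v : V) : Prop :=
  ∀ i, (Gr i).Adj u v →
    ∃ Y B, IsSBlock (Gr i) S Y ∧ Y.Adj u v ∧ B ∈ nontrivialBlocks D ∧ B ≤ Y ∧ Q B = q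

namespace BoundaryModel

theorem finite (M : BoundaryModel Gr S D L Q) (i : Bool) : (Gr i).verts.Finite :=
  (M.side i).finite

theorem hasModelAt_of_side (M : BoundaryModel Gr S D L Q) (h : IsAmalgam Gr S D) {i : Bool}
    {Y B : VGraph V} (hY : IsSBlock (Gr i) S Y) (hB : B ∈ nontrivialBlocks D) (hBY : B ≤ Y)
    {u v : V} (huv : Y.Adj u v) : HasModelAt Gr S D Q (Q B) u v := by
  intro j hj
  by_cases hij : i = j
  · subst hij
    exact ⟨Y, B, hY, huv, hB, hBY, rfl⟩
  · have hi := hY.1.le.2 huv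
    have hD : D.Adj u v := h.adj_of_ne hij hi.fst_mem hi.snd_mem hj
    obtain ⟨B', hB', hB'uv⟩ := exists_nontrivialBlock (h.verts_finite M.finite) hD
    obtain ⟨Y', hY', hY'uv⟩ := exists_block_of_adj (M.finite j) hj
    have hle := h.le_of_adj hY' hB' hB'uv hY'uv
    exact ⟨Y', B', h.isSBlock_of_le hY' hB' hle, hY'uv, hB', hle,
      (M.side i).coincidence Y hY B hB hBY B' hB' (h.le_of_adj hY.1 hB' hB'uv huv)⟩

variable {X B : VGraph V}

/-- All blocks of the sides inside a block `X` of the union have the same model. -/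
theorem hasModelAt (M : BoundaryModel Gr S D L Q) (h : IsAmalgam Gr S D)
    (hT : (auxSum (Gr false) (Gr true) S).coe.IsAcyclic) (hX : IsBlockOf (amalgamSum Gr) X)
    (hB : B ∈ nontrivialBlocks D) (hBX : B ≤ X) {u v : V} (huv : X.Adj u v) :
    HasModelAt Gr S D Q (Q B) u v := by
  obtain ⟨x, y, hxy⟩ := exists_adj_of_mem_nontrivialBlocks hB
  refine hX.walkBiconnected.forall_adj (p := HasModelAt Gr S D Q (Q B)) ?_ ?_ (hBX.2 hxy) ?_
    u v huv
  · intro u v huv i hi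
    obtain ⟨Y, B', h1, h2, h3⟩ := huv i hi.symm
    exact ⟨Y, B', h1, h2.symm, h3⟩
  · intro v a b ha hb hpa
    have hab := (hX.walkBiconnected.avoid v a ha.snd_mem b hb.snd_mem ha.ne.symm hb.ne.symm).mono
      hX.le
    have hlink := h.sideLink_of_avoidReach hT (hX.le.2 ha) (hX.le.2 hb) hab
    clear hab hb
    induction hlink with
    | refl => exact hpa
    | tail _ hcc ih =>
      obtain ⟨i, hc, hc', hav⟩ := hcc
      obtain ⟨Y, B', hY, hYc, hB', hB'Y, hQ⟩ := ih i hc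
      rw [← hQ]
      exact M.hasModelAt_of_side h hY hB' hB'Y (hY.1.adj_of_avoidReach hYc hc' hav)
  · obtain ⟨Y, hY, hYxy⟩ := exists_block_of_adj (M.finite false)
      ((h.le false).2 (hB.1.le.2 hxy))
    have hle := h.le_of_adj hY hB hxy hYxy
    exact M.hasModelAt_of_side h (h.isSBlock_of_le hY hB hle) hB hle hYxy

theorem block_le {i : Bool} {Y : VGraph V} (hX : IsBlockOf (amalgamSum Gr) X)
    (hY : IsBlockOf (Gr i) Y) {u v : V} (huv : X.Adj u v) (hYuv : Y.Adj u v) : Y ≤ X :=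
  hX.le_of_adj hY.walkBiconnected (hY.le.trans (le_amalgamSum Gr i)) huv hYuv

theorem label_adj (M : BoundaryModel Gr S D L Q) (h : IsAmalgam Gr S D)
    (hT : (auxSum (Gr false) (Gr true) S).coe.IsAcyclic) (hX : IsBlockOf (amalgamSum Gr) X)
    (hB : B ∈ nontrivialBlocks D) (hBX : B ≤ X) {u v : V} (huv : X.Adj u v) :
    (Q B).Adj (L u) (L v) := by
  obtain ⟨i, hi⟩ := amalgamSum_adj.1 (hX.le.2 huv)
  obtain ⟨Y, B', hY, hYuv, hB', hB'Y, hQ⟩ := M.hasModelAt h hT hX hB hBX huv i hi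
  rw [← hQ]
  exact ((M.side i).adj_iff Y hY B' hB' hB'Y u hYuv.fst_mem v hYuv.snd_mem).1 hYuv

/-- In a block of the union, the neighbors of a vertex induce a connected graph. -/
theorem neighborGraph_reachable (M : BoundaryModel Gr S D L Q) (h : IsAmalgam Gr S D)
    (hT : (auxSum (Gr false) (Gr true) S).coe.IsAcyclic) (hX : IsBlockOf (amalgamSum Gr) X)
    (hB : B ∈ nontrivialBlocks D) (hBX : B ≤ X) {w a b : V} (ha : X.Adj w a) (hb : X.Adj w b) :
    (neighborGraph X w).Reachable a b := by
  have hab := (hX.walkBiconnected.avoid w a ha.snd_mem b hb.snd_mem ha.ne.symm hb.ne.symm).mono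
    hX.le
  have hlink := h.sideLink_of_avoidReach hT (hX.le.2 ha) (hX.le.2 hb) hab
  suffices hs : ∀ c, Relation.ReflTransGen (SideLink Gr w) a c →
      X.Adj w c ∧ (neighborGraph X w).Reachable a c from (hs b hlink).2
  intro c hc
  induction hc with
  | refl => exact ⟨ha, .rfl⟩
  | @tail c c' _ hcc ih =>
    obtain ⟨i, hic, hic', hav⟩ := hcc
    obtain ⟨Y, B', hY, hYc, hB', hB'Y, hQ⟩ := M.hasModelAt h hT hX hB hBX ih.1 i hic
    have hYc' := hY.1.adj_of_avoidReach hYc hic' hav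
    have hYX := block_le hX hY.1 ih.1 hYc
    refine ⟨hYX.2 hYc', ih.2.trans ?_⟩
    have hreach := ((M.side i).chordal_side Y hY).neighborGraph_reachable hYc hYc'
      (hY.1.walkBiconnected.avoid w c hYc.snd_mem c' hYc'.snd_mem hYc.ne.symm hYc'.ne.symm)
    refine hreach.mono ?_
    intro _ _ hadj
    exact ⟨hYX.2 hadj.1, hYX.2 hadj.2.1, hYX.2 hadj.2.2⟩

/-- The labels embed the neighborhood of each vertex `w` of `X` into the model. For two neighbors
of `w` with a common neighbor `c` next to `w` this holds because both lie in one side, or because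
the model separates the two sides at the edge `wc`; chordality of the model does the rest. -/
theorem label_local (M : BoundaryModel Gr S D L Q) (h : IsAmalgam Gr S D)
    (hT : (auxSum (Gr false) (Gr true) S).coe.IsAcyclic) (hX : IsBlockOf (amalgamSum Gr) X)
    (hB : B ∈ nontrivialBlocks D) (hBX : B ≤ X) {w x y : V} (hx : X.Adj w x) (hy : X.Adj w y)
    (hne : x ≠ y) : L x ≠ L y ∧ ((Q B).Adj (L x) (L y) → X.Adj x y) := by
  have hside : ∀ i c x y, X.Adj w c → (Gr i).Adj w c → (Gr i).Adj w x → (Gr i).Adj c x →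
      (Gr i).Adj w y → (Gr i).Adj c y → x ≠ y →
      L x ≠ L y ∧ ((Q B).Adj (L x) (L y) → X.Adj x y) := by
    intro i c x y hXc hc hwx hcx hwy hcy hne
    obtain ⟨Y, B', hY, hYc, hB', hB'Y, hQ⟩ := M.hasModelAt h hT hX hB hBX hXc i hc
    have hYx := (hY.1.adj_of_triangle hYc hwx hcx).1
    have hYy := (hY.1.adj_of_triangle hYc hwy hcy).1
    rw [← hQ]
    refine ⟨fun heq => hne ((M.side i).label_injOn Y hY B' hB' hB'Y hYx.snd_mem hYy.snd_mem heq),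
      fun hadj => (block_le hX hY.1 hXc hYc).2 ?_⟩
    exact ((M.side i).adj_iff Y hY B' hB' hB'Y x hYx.snd_mem y hYy.snd_mem).2 hadj
  have := (M.chordal B hB).embedding_of_local (F := neighborGraph X w) L
    (fun x y hxy => M.label_adj h hT hX hB hBX hxy.1) ?_
    (M.neighborGraph_reachable h hT hX hB hBX hx hy) hne
  · exact ⟨this.1, fun hadj => (this.2 hadj).1⟩
  rintro c x y ⟨hcx, hwc, hwx⟩ ⟨hcy, -, hwy⟩ hne
  suffices hs : L x ≠ L y ∧ ((Q B).Adj (L x) (L y) → X.Adj x y) from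
    ⟨hs.1, fun hadj => ⟨hs.2 hadj, hwx, hwy⟩⟩
  obtain ⟨i, hic, hix, hicx⟩ := h.exists_triangle (hX.le.2 hwc) (hX.le.2 hwx) (hX.le.2 hcx)
  obtain ⟨j, hjc, hjy, hjcy⟩ := h.exists_triangle (hX.le.2 hwc) (hX.le.2 hwy) (hX.le.2 hcy)
  by_cases hij : i = j
  · subst hij
    exact hside i c x y hwc hic hix hicx hjy hjcy hne
  have hwcD : D.Adj w c := h.adj_of_ne hij hic.fst_mem hic.snd_mem hjc
  have hwcS := (h.adj_iff i).1 hwcD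
  by_cases hxS : x ∈ S
  · exact hside j c x y hwc hjc ((h.le j).2 ((h.adj_iff i).2 ⟨hwcS.1, hxS, hix⟩))
      ((h.le j).2 ((h.adj_iff i).2 ⟨hwcS.2.1, hxS, hicx⟩)) hjy hjcy hne
  by_cases hyS : y ∈ S
  · exact hside i c x y hwc hic hix hicx ((h.le i).2 ((h.adj_iff j).2 ⟨hwcS.1, hyS, hjy⟩))
      ((h.le i).2 ((h.adj_iff j).2 ⟨hwcS.2.1, hyS, hjcy⟩)) hne
  obtain ⟨B', hB', hB'wc⟩ := exists_nontrivialBlock (h.verts_finite M.finite) hwcD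
  obtain ⟨Y, B₁, hY, hYc, hB₁, hB₁Y, hQ⟩ := M.hasModelAt h hT hX hB hBX hwc i hic
  have hQ' := (M.side i).coincidence Y hY B₁ hB₁ hB₁Y B' hB' (h.le_of_adj hY.1 hB' hB'wc hYc)
  have hsep := M.separated B' hB' i j hij w c x y hB'wc hix hicx hjy hjcy hxS hyS
  rw [hQ', hQ] at hsep
  exact ⟨hsep.1, fun hadj => absurd hadj hsep.2⟩

theorem label_embedding (M : BoundaryModel Gr S D L Q) (h : IsAmalgam Gr S D)
    (hT : (auxSum (Gr false) (Gr true) S).coe.IsAcyclic) (hX : IsBlockOf (amalgamSum Gr) X)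
    (hB : B ∈ nontrivialBlocks D) (hBX : B ≤ X) {x y : V} (hx : x ∈ X.verts) (hy : y ∈ X.verts)
    (hne : x ≠ y) : L x ≠ L y ∧ ((Q B).Adj (L x) (L y) → X.Adj x y) :=
  (M.chordal B hB).embedding_of_local (F := X.spanningCoe) L
    (fun _ _ hxy => M.label_adj h hT hX hB hBX hxy)
    (fun _ _ _ h1 h2 h3 => M.label_local h hT hX hB hBX h1 h2 h3)
    ((SimpleGraph.reachable_iff_reflTransGen x y).2 (hX.walkBiconnected.reach x hx y hy)) hne

/-- The labels map the neighborhood of each vertex of `X` onto a neighborhood in the model. If no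
edge of `D` in `X` is incident with `w`, a single block of a side is responsible. Otherwise
connectivity of the neighborhood in the model reduces the claim to common neighbors of `w` and a
neighbor `x`. -/
theorem label_neighbor_surjective (M : BoundaryModel Gr S D L Q) (h : IsAmalgam Gr S D)
    (hT : (auxSum (Gr false) (Gr true) S).coe.IsAcyclic) (hX : IsBlockOf (amalgamSum Gr) X)
    (hB : B ∈ nontrivialBlocks D) (hBX : B ≤ X) {w : V} (hw : w ∈ X.verts) {l : Λ}
    (hl : (Q B).Adj (L w) l) : ∃ y, X.Adj w y ∧ L y = l := by
  obtain ⟨x, hwx⟩ : ∃ x, X.Adj w x := by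
    obtain ⟨a, ha, b, hb, hab⟩ := hB.2
    by_cases haw : a = w
    · exact hX.walkBiconnected.exists_adj hw (hBX.1 hb) (haw ▸ hab)
    · exact hX.walkBiconnected.exists_adj hw (hBX.1 ha) (Ne.symm haw)
  by_cases hD : ∃ c, X.Adj w c ∧ D.Adj w c
  swap
  · obtain ⟨i, hi⟩ := amalgamSum_adj.1 (hX.le.2 hwx)
    obtain ⟨Y, B', hY, hYx, hB', hB'Y, hQ⟩ := M.hasModelAt h hT hX hB hBX hwx i hi
    have hYX := block_le hX hY.1 hwx hYx
    rw [← hQ] at hl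
    obtain ⟨y, hy, hyl⟩ := (M.side i).complete Y hY B' hB' hB'Y w hYx.fst_mem
      (fun c hc hc' => hD ⟨c, hYX.2 hc, hc'⟩) l hl
    exact ⟨y, hYX.2 hy, hyl⟩
  · obtain ⟨c, hwc, hDwc⟩ := hD
    have hwS := ((h.adj_iff false).1 hDwc).1
    have hstep : ∀ x l, X.Adj w x → (Q B).Adj (L w) l → (Q B).Adj (L x) l →
        ∃ y, X.Adj w y ∧ L y = l := by
      intro x l hwx hwl hxl
      obtain ⟨i, hi⟩ := amalgamSum_adj.1 (hX.le.2 hwx)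
      obtain ⟨Y, B', hY, hYx, hB', hB'Y, hQ⟩ := M.hasModelAt h hT hX hB hBX hwx i hi
      by_cases hxS : x ∈ S
      · have hwxD := (h.adj_iff i).2 ⟨hwS, hxS, hi⟩
        obtain ⟨B₁, hB₁, hB₁wx⟩ := exists_nontrivialBlock (h.verts_finite M.finite) hwxD
        have hQ' := (M.side i).coincidence Y hY B' hB' hB'Y B₁ hB₁ (h.le_of_adj hY.1 hB₁ hB₁wx hYx)
        rw [← hQ, ← hQ'] at hwl hxl
        obtain ⟨y, j, hwy, hxy, hyl⟩ := M.extend B₁ hB₁ w x l hB₁wx hwl hxl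
        exact ⟨y, (hX.adj_of_triangle hwx ((le_amalgamSum Gr j).2 hwy)
          ((le_amalgamSum Gr j).2 hxy)).1, hyl⟩
      · rw [← hQ] at hwl hxl
        obtain ⟨y, hxy, hyl⟩ := (M.side i).complete Y hY B' hB' hB'Y x hYx.snd_mem
          (fun c _ hc => hxS ((h.adj_iff false).1 hc).1) l hxl
        refine ⟨y, (block_le hX hY.1 hwx hYx).2 ?_, hyl⟩
        rw [(M.side i).adj_iff Y hY B' hB' hB'Y w hYx.fst_mem y hxy.snd_mem, hyl]
        exact hwl
    have hwcQ := M.label_adj h hT hX hB hBX hwc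
    have hreach := (M.chordal B hB).neighborGraph_reachable hwcQ hl
      ((M.biconnected B hB).avoid _ _ hwcQ.snd_mem _ hl.snd_mem hwcQ.ne.symm hl.ne.symm)
    rw [SimpleGraph.reachable_iff_reflTransGen] at hreach
    clear hl
    induction hreach with
    | refl => exact ⟨c, hwc, rfl⟩
    | tail _ hadj ih =>
      obtain ⟨y, hwy, rfl⟩ := ih
      exact hstep y _ hwy hadj.2.2 hadj.1

/-- A block of the union that contains the non-trivial block `B` of `D` is isomorphic to the model
of `B` through its labels. -/
theorem label_isomorphism (M : BoundaryModel Gr S D L Q) (h : IsAmalgam Gr S D)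
    (hT : (auxSum (Gr false) (Gr true) S).coe.IsAcyclic) (hX : IsBlockOf (amalgamSum Gr) X)
    (hB : B ∈ nontrivialBlocks D) (hBX : B ≤ X) :
    Set.InjOn L X.verts ∧ L '' X.verts = (Q B).verts ∧
      ∀ x ∈ X.verts, ∀ y ∈ X.verts, (X.Adj x y ↔ (Q B).Adj (L x) (L y)) := by
  refine ⟨?_, ?_, ?_⟩
  · intro x hx y hy heq
    by_contra hne
    exact (M.label_embedding h hT hX hB hBX hx hy hne).1 heq
  · obtain ⟨x, y, hxy⟩ := exists_adj_of_mem_nontrivialBlocks hB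
    have hX₀ := hBX.2 hxy
    apply Set.Subset.antisymm
    · rintro _ ⟨z, hz, rfl⟩
      by_cases hzx : z = x
      · rw [hzx]
        exact (M.label_adj h hT hX hB hBX hX₀).fst_mem
      · obtain ⟨c, hc⟩ := hX.walkBiconnected.exists_adj hz hX₀.fst_mem hzx
        exact (M.label_adj h hT hX hB hBX hc).fst_mem
    · intro l hl
      have hreach := (M.biconnected B hB).reach _ (M.label_adj h hT hX hB hBX hX₀).fst_mem l hl
      clear hl
      induction hreach with
      | refl => exact ⟨x, hX₀.fst_mem, rfl⟩
      | tail _ hadj ih =>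
        obtain ⟨z, hz, rfl⟩ := ih
        obtain ⟨y, hy, hyl⟩ := M.label_neighbor_surjective h hT hX hB hBX hz hadj
        exact ⟨y, hy.snd_mem, hyl⟩
  · intro x hx y hy
    refine ⟨fun hxy => M.label_adj h hT hX hB hBX hxy, fun hxy => ?_⟩
    refine (M.label_embedding h hT hX hB hBX hx hy ?_).2 hxy
    rintro rfl
    exact hxy.ne rfl

end BoundaryModel

/-- A block of the union that contains no edge of `D` is a block of one of the sides. -/
theorem IsAmalgam.block_cases (h : IsAmalgam Gr S D) (hfin : ∀ i, (Gr i).verts.Finite)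
    (hT : (auxSum (Gr false) (Gr true) S).coe.IsAcyclic) {X : VGraph V}
    (hX : IsBlockOf (amalgamSum Gr) X) :
    (∃ i, IsBlockOf (Gr i) X) ∨ ∃ B ∈ nontrivialBlocks D, B ≤ X := by
  by_cases hD : ∃ x y, X.Adj x y ∧ D.Adj x y
  · obtain ⟨x, y, hxy, hDxy⟩ := hD
    obtain ⟨B, hB, hBxy⟩ := exists_nontrivialBlock (h.verts_finite hfin) hDxy
    exact Or.inr ⟨B, hB, hX.le_of_adj hB.1.walkBiconnected (hB.1.le.trans h.le_sum) hxy hBxy⟩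
  left
  have hmax : ∀ i Y, IsBlockOf (Gr i) Y → X ≤ Y → IsBlockOf (Gr i) X := by
    intro i Y hY hXY
    rwa [hX.eq_of_le hY.walkBiconnected (hY.le.trans (le_amalgamSum Gr i)) hXY]
  obtain ⟨x, hx⟩ := hX.walkBiconnected.nonempty
  by_cases hedge : ∃ y, X.Adj x y
  · obtain ⟨y, hxy⟩ := hedge
    obtain ⟨i, hi⟩ := amalgamSum_adj.1 (hX.le.2 hxy)
    obtain ⟨Y, hY, hYxy⟩ := exists_block_of_adj (hfin i) hi
    refine ⟨i, hmax i Y hY ?_⟩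
    have hall : ∀ u v, X.Adj u v → Y.Adj u v := by
      refine hX.walkBiconnected.forall_adj (p := Y.Adj) (fun _ _ h => h.symm) ?_ hxy hYxy
      intro v a b ha hb hYa
      have hab := (hX.walkBiconnected.avoid v a ha.snd_mem b hb.snd_mem ha.ne.symm hb.ne.symm).mono
        hX.le
      have hlink := h.sideLink_of_avoidReach hT (hX.le.2 ha) (hX.le.2 hb) hab
      suffices hs : ∀ c, Relation.ReflTransGen (SideLink Gr v) a c → X.Adj v c ∧ Y.Adj v c from
        (hs b hlink).2
      intro c hc
      induction hc with
      | refl => exact ⟨ha, hYa⟩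
      | @tail c c' _ hcc ih =>
        obtain ⟨j, hjc, hjc', hav⟩ := hcc
        have hXc' := hX.adj_of_avoidReach ih.1 ((le_amalgamSum Gr j).2 hjc')
          (hav.mono (le_amalgamSum Gr j))
        refine ⟨hXc', ?_⟩
        by_cases hij : i = j
        · subst hij
          exact hY.adj_of_avoidReach ih.2 hjc' hav
        · have hic := hY.le.2 ih.2
          exact absurd ⟨v, c, ih.1, h.adj_of_ne hij hic.fst_mem hic.snd_mem hjc⟩ hD
    refine ⟨fun z hz => ?_, fun u v huv => hall u v huv⟩
    by_cases hzx : z = x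
    · exact hzx ▸ hYxy.fst_mem
    · obtain ⟨c, hc⟩ := hX.walkBiconnected.exists_adj hz hx hzx
      exact (hall z c hc).fst_mem
  · -- Without edges, `X` is a single vertex.
    obtain ⟨i, hi⟩ := mem_amalgamSum.1 (hX.le.1 hx)
    obtain ⟨Y, hY, hYx⟩ := (walkBiconnected_singletonSubgraph x).exists_block (hfin i)
      (SimpleGraph.singletonSubgraph_le_iff _ _ |>.2 hi)
    have hsingle : ∀ z ∈ X.verts, z = x := by
      intro z hz
      by_contra hzx
      exact hedge (hX.walkBiconnected.exists_adj hx hz (Ne.symm hzx))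
    refine ⟨i, hmax i Y hY ⟨fun z hz => ?_, fun u v huv => ?_⟩⟩
    · rw [hsingle z hz]
      exact hYx.1 (by simp)
    · exact absurd ((hsingle u huv.fst_mem).trans (hsingle v huv.snd_mem).symm) huv.ne

end Model

/-! ### Graphs as graphs on their labels -/

section LabelGraph

variable {d : ℕ}

/-- The image of `G` under its labeling, a graph on labels. For an injective labeling it is the
isomorphism type of `G` as a labeled graph. -/
def labelGraph {V : Type*} (G : VGraph V) (L : V → Fin d) : VGraph (Fin d) where
  verts := L '' G.verts
  Adj i j := i ≠ j ∧ ∃ x y, G.Adj x y ∧ L x = i ∧ L y = j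
  adj_sub h := h.1
  edge_vert := by
    rintro i j ⟨-, x, y, hxy, rfl, -⟩
    exact ⟨x, hxy.fst_mem, rfl⟩
  symm := ⟨by
    rintro i j ⟨hij, x, y, hxy, hx, hy⟩
    exact ⟨hij.symm, y, x, hxy.symm, hy, hx⟩⟩

theorem labelGraph_adj {V : Type*} {G : VGraph V} {L : V → Fin d} (hL : Set.InjOn L G.verts)
    {x y : V} (hx : x ∈ G.verts) (hy : y ∈ G.verts) :
    (labelGraph G L).Adj (L x) (L y) ↔ G.Adj x y := by
  constructor
  · rintro ⟨-, x', y', h, hx', hy'⟩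
    rwa [hL h.fst_mem hx hx', hL h.snd_mem hy hy'] at h
  · intro h
    exact ⟨fun heq => h.ne (hL hx hy heq), x, y, h, rfl, rfl⟩

/-- Injectively labeled graphs with the same labels and the same adjacencies between labels are
isomorphic. -/
theorem exists_iso_of_labels {V V' : Type*} {Λ : Type*} {G : VGraph V} {L : V → Λ} {G' : VGraph V'}
    {L' : V' → Λ} (hL : Set.InjOn L G.verts) (hL' : Set.InjOn L' G'.verts)
    (himage : L '' G.verts = L' '' G'.verts)
    (hadj : ∀ x ∈ G.verts, ∀ y ∈ G.verts, ∀ x' ∈ G'.verts, ∀ y' ∈ G'.verts, L' x' = L x →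
      L' y' = L y → (G.Adj x y ↔ G'.Adj x' y')) :
    ∃ e : G.coe ≃g G'.coe, ∀ v, L' (e v) = L v := by
  have hex : ∀ v : G.verts, ∃ v' : G'.verts, L' v' = L v := by
    intro v
    obtain ⟨v', hv', h⟩ := himage ▸ Set.mem_image_of_mem L v.2
    exact ⟨⟨v', hv'⟩, h⟩
  choose f hf using hex
  have hbij : Function.Bijective f := by
    constructor
    · intro v w h
      exact Subtype.ext (hL v.2 w.2 (by rw [← hf v, ← hf w, h]))
    · intro v'
      obtain ⟨v, hv, h⟩ := himage.symm ▸ Set.mem_image_of_mem L' v'.2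
      exact ⟨⟨v, hv⟩, Subtype.ext (hL' (f ⟨v, hv⟩).2 v'.2 ((hf _).trans h))⟩
  refine ⟨⟨Equiv.ofBijective f hbij, ?_⟩, hf⟩
  intro v w
  exact (hadj v v.2 w w.2 (f v) (f v).2 (f w) (f w).2 (hf v) (hf w)).symm

theorem IsChordalGraph.of_iso {W : Type*} {W' : Type*} {G : SimpleGraph W} {G' : SimpleGraph W'}
    (hG : IsChordalGraph G) (e : G ≃g G') : IsChordalGraph G' :=
  fun n hn => ⟨fun f => (hG n hn).false (f.trans e.symm.toEmbedding)⟩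

theorem IsChordalGraph.labelGraph {V : Type*} {G : VGraph V} {L : V → Fin d}
    (hG : IsChordalGraph G.coe) (hL : Set.InjOn L G.verts) :
    IsChordalGraph (labelGraph G L).coe := by
  obtain ⟨e, -⟩ := exists_iso_of_labels (G := G) (L := L) (G' := _root_.labelGraph G L) (L' := id)
    hL Function.injective_id.injOn (by simp [_root_.labelGraph]) (by
      rintro x hx y hy _ - _ - rfl rfl
      exact (labelGraph_adj hL hx hy).symm)
  exact hG.of_iso e

theorem WalkBiconnected.labelGraph {V : Type*} {G : VGraph V} {L : V → Fin d}
    (hG : WalkBiconnected G) (hL : Set.InjOn L G.verts) :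
    WalkBiconnected (labelGraph G L) := by
  have hadj : ∀ {x y}, G.Adj x y → (_root_.labelGraph G L).Adj (L x) (L y) := fun h =>
    (labelGraph_adj hL h.fst_mem h.snd_mem).2 h
  refine ⟨hG.nonempty.image L, ?_, ?_⟩
  · rintro _ ⟨x, hx, rfl⟩ _ ⟨y, hy, rfl⟩
    exact Relation.ReflTransGen.lift L (fun _ _ h => hadj h) _ _ (hG.reach x hx y hy)
  · rintro l _ ⟨x, hx, rfl⟩ _ ⟨y, hy, rfl⟩ hxl hyl
    by_cases hl : l ∈ L '' G.verts
    · obtain ⟨v, hv, rfl⟩ := hl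
      refine Relation.ReflTransGen.lift L (fun a b h => ⟨hadj h.1, ?_, ?_⟩) _ _
        (hG.avoid v x hx y hy (fun h => hxl (congrArg L h)) (fun h => hyl (congrArg L h)))
      · exact fun heq => h.2.1 (hL h.1.fst_mem hv heq)
      · exact fun heq => h.2.2 (hL h.1.snd_mem hv heq)
    · refine Relation.ReflTransGen.lift L (fun a b h => ⟨hadj h, ?_, ?_⟩) _ _ (hG.reach x hx y hy)
      · rintro rfl; exact hl ⟨a, h.fst_mem, rfl⟩
      · rintro rfl; exact hl ⟨b, h.snd_mem, rfl⟩

variable {V V' : Type u}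

theorem LabelIso.labelGraph_eq {G : VGraph V} {L : V → Fin d} {G' : VGraph V'} {L' : V' → Fin d}
    (h : LabelIso G L G' L') : labelGraph G L = labelGraph G' L' := by
  obtain ⟨e, he⟩ := h
  refine SimpleGraph.Subgraph.ext ?_ ?_
  · ext l
    constructor
    · rintro ⟨x, hx, rfl⟩
      exact ⟨e ⟨x, hx⟩, (e ⟨x, hx⟩).2, he _⟩
    · rintro ⟨x, hx, rfl⟩
      refine ⟨e.symm ⟨x, hx⟩, (e.symm ⟨x, hx⟩).2, ?_⟩
      rw [← he, e.apply_symm_apply]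
  · funext i j
    refine propext (and_congr_right fun _ => ⟨?_, ?_⟩)
    · rintro ⟨x, y, hxy, rfl, rfl⟩
      have h1 : G.coe.Adj ⟨x, hxy.fst_mem⟩ ⟨y, hxy.snd_mem⟩ := hxy
      exact ⟨_, _, e.map_adj_iff.2 h1, he _, he _⟩
    · rintro ⟨x, y, hxy, rfl, rfl⟩
      have h1 : G'.coe.Adj ⟨x, hxy.fst_mem⟩ ⟨y, hxy.snd_mem⟩ := hxy
      refine ⟨_, _, e.symm.map_adj_iff.2 h1, ?_, ?_⟩
      · rw [← he, e.apply_symm_apply]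
      · rw [← he, e.apply_symm_apply]

theorem LabelIso.injOn {G : VGraph V} {L : V → Fin d} {G' : VGraph V'} {L' : V' → Fin d}
    (h : LabelIso G L G' L') (hL' : Set.InjOn L' G'.verts) : Set.InjOn L G.verts := by
  obtain ⟨e, he⟩ := h
  intro x hx y hy hxy
  have h1 := hL' (e ⟨x, hx⟩).2 (e ⟨y, hy⟩).2 (by rw [he, he]; exact hxy)
  exact congrArg Subtype.val (e.injective (Subtype.ext h1))

/-- A partial label-isomorphism to an injectively labeled graph is an induced embedding into its
graph of labels. -/
theorem PartialLabelIso.embedding {X : VGraph V} {L : V → Fin d} {Q : VGraph V'} {L' : V' → Fin d}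
    (h : PartialLabelIso X L Q L') (hL' : Set.InjOn L' Q.verts) :
    Set.InjOn L X.verts ∧ (∀ x ∈ X.verts, L x ∈ (labelGraph Q L').verts) ∧
      ∀ x ∈ X.verts, ∀ y ∈ X.verts, (X.Adj x y ↔ (labelGraph Q L').Adj (L x) (L y)) := by
  have hL : Set.InjOn L X.verts := h.injOn (hL'.mono fun q hq => hq.1)
  have heq := h.labelGraph_eq
  refine ⟨hL, fun x hx => ?_, fun x hx y hy => ?_⟩
  · have : L x ∈ (labelGraph X L).verts := ⟨x, hx, rfl⟩
    rw [heq] at this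
    obtain ⟨q, hq, hqx⟩ := this
    exact ⟨q, hq.1, hqx⟩
  · rw [← labelGraph_adj hL hx hy, heq]
    constructor
    · rintro ⟨hne, p, q, hpq, hp, hq⟩
      exact ⟨hne, p, q, hpq.2.2, hp, hq⟩
    · rintro ⟨hne, p, q, hpq, hp, hq⟩
      exact ⟨hne, p, q, ⟨⟨hpq.fst_mem, x, hx, hp.symm⟩, ⟨hpq.snd_mem, y, hy, hq.symm⟩, hpq⟩, hp, hq⟩

end LabelGraph

/-! ### Models from characteristics and from respected sums -/

section Characteristic

variable {V : Type u} {d : ℕ}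

theorem SideModel.congr {G : VGraph V} {S : Set V} {D : VGraph V} {Λ : Type*} {L L' : V → Λ}
    {Q : VGraph V → VGraph Λ} (M : SideModel G S D L Q) (h : Set.EqOn L' L G.verts) :
    SideModel G S D L' Q where
  finite := M.finite
  chordal_side := M.chordal_side
  label_mem Y hY B hB hBY x hx := by
    rw [h (hY.1.le.1 hx)]
    exact M.label_mem Y hY B hB hBY x hx
  label_injOn Y hY B hB hBY := (M.label_injOn Y hY B hB hBY).congr fun x hx =>
    (h (hY.1.le.1 hx)).symm
  adj_iff Y hY B hB hBY x hx y hy := by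
    rw [h (hY.1.le.1 hx), h (hY.1.le.1 hy)]
    exact M.adj_iff Y hY B hB hBY x hx y hy
  coincidence := M.coincidence
  complete Y hY B hB hBY w hw hD l hl := by
    rw [h (hY.1.le.1 hw)] at hl
    obtain ⟨y, hy, hyl⟩ := M.complete Y hY B hB hBY w hw hD l hl
    exact ⟨y, hy, (h (hY.1.le.1 hy.snd_mem)).trans hyl⟩

theorem isBlockOf_self {G : VGraph V} (h : IsBiconnected G.coe) : IsBlockOf G G :=
  ⟨⟨le_rfl, h⟩, fun _ hK _ => hK.1⟩

/-- The graph `g B` as a graph on labels. -/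
abbrev modelGraph (g : VGraph V → LabeledGraph.{u} d) (B : VGraph V) : VGraph (Fin d) :=
  labelGraph (g B).graph (g B).label

variable {P : GraphClass.{u}} {S : Set V} {D : VGraph V} {g : VGraph V → LabeledGraph.{u} d}
  {h : VGraph V → Set (Fin d)}

theorem LabeledGraph.MemU.injOn {Q : LabeledGraph.{u} d} (hQ : Q.MemU P) :
    Set.InjOn Q.label Q.graph.verts :=
  hQ.1.2.1 _ (isBlockOf_self hQ.2)

theorem LabeledGraph.MemU.mem_class {Q : LabeledGraph.{u} d} (hQ : Q.MemU P) : P Q.graph.coe :=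
  hQ.1.2.2 _ (isBlockOf_self hQ.2)

variable {Gr : Bool → VGraph V}

theorem IsAmalgam.boundaryBlocks_eq (hA : IsAmalgam Gr S D) (i : Bool) :
    boundaryBlocks (Gr i) S = nontrivialBlocks D := by
  rw [← hA.induce_eq i]
  rfl

/-- A characteristic of a side provides a model of this side. -/
theorem IsCharacteristic.sideModel {i : Bool} {L : V → Fin d} (hP : P.Chordal)
    (hA : IsAmalgam Gr S D) (hG : IsLabeledPBlockGraph P (Gr i) L)
    (hgh : IsCharacteristic P (Gr i) S L g h) : SideModel (Gr i) S D L (modelGraph g) := by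
  have hBs := hA.boundaryBlocks_eq i
  have hinj : ∀ B ∈ nontrivialBlocks D, Set.InjOn (g B).label (g B).graph.verts := fun B hB =>
    (hgh.memU B (hBs ▸ hB)).injOn
  have hemb := fun B hB Y hY hBY =>
    (hgh.label_isomorphism B (hBs ▸ hB) Y hY hBY).embedding (hinj B hB)
  refine ⟨hG.1, fun Y hY => hP _ (hG.2.2 Y hY.1), fun Y hY B hB hBY => (hemb B hB Y hY hBY).2.1,
    fun Y hY B hB hBY => (hemb B hB Y hY hBY).1, fun Y hY B hB hBY => (hemb B hB Y hY hBY).2.2,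
    fun Y hY B hB hBY B' hB' hB'Y =>
      (hgh.coincidence B (hBs ▸ hB) Y hY hBY B' (hBs ▸ hB') hB'Y).labelGraph_eq, ?_⟩
  intro Y hY B hB hBY w hw hwD l hl
  have hcase : w ∈ Y.verts \ S ∨
      ∃ C ∈ componentSets ((Gr i).induce S), {w} = Y.verts ∩ C := by
    by_cases hwS : w ∈ S
    · rw [hA.induce_eq i]
      refine Or.inr ⟨_, setOf_walkReach_mem_componentSets (hA.verts_eq ▸ hwS), ?_⟩
      ext x
      constructor
      · rintro rfl
        exact ⟨hw, Relation.ReflTransGen.refl⟩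
      · rintro ⟨hx, hwx⟩
        by_contra hne
        obtain ⟨c, hc, hcD⟩ := hY.1.exists_adj_of_walkReach (hA.le i) hw hx hne hwx
        exact hwD c hc hcD
    · exact Or.inl ⟨hw, hwS⟩
  obtain ⟨z, hz, hzw⟩ := (hemb B hB Y hY hBY).2.1 w hw
  have heq := (hgh.completeness B (hBs ▸ hB) Y hY hBY w hcase z hz hzw).labelGraph_eq
  obtain ⟨hne, p, q, hpq, hp, hq⟩ := hl
  obtain rfl : p = z := hinj B hB hpq.fst_mem hz (hp.trans hzw.symm)
  have hmem : l ∈ (labelGraph (closedNeighborhood (g B).graph p) (g B).label).verts :=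
    ⟨q, Or.inr hpq, hq⟩
  rw [← heq] at hmem
  obtain ⟨y, rfl | hy, hyl⟩ := hmem
  · exact absurd hyl hne
  · exact ⟨y, hy, hyl⟩

/-- A common neighbor, outside `S`, of the ends of an edge of `B` has its label in `h B`. -/
theorem IsCharacteristic.label_mem_of_adj {i : Bool} {L : V → Fin d} (hA : IsAmalgam Gr S D)
    (hfin : (Gr i).verts.Finite) (hgh : IsCharacteristic P (Gr i) S L g h) {B : VGraph V}
    (hB : B ∈ nontrivialBlocks D) {w c x : V} (hwc : B.Adj w c) (hwx : (Gr i).Adj w x)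
    (hcx : (Gr i).Adj c x) (hx : x ∉ S) : L x ∈ h B := by
  obtain ⟨Y, hY, hYwc⟩ := exists_block_of_adj hfin ((hA.le i).2 (hB.1.le.2 hwc))
  have hBY := hA.le_of_adj hY hB hwc hYwc
  rw [hgh.neighborhood B (hA.boundaryBlocks_eq i ▸ hB) Y (hA.isSBlock_of_le hY hB hBY) hBY]
  refine ⟨x, ⟨⟨⟨w, hwc.fst_mem, (hY.adj_of_triangle hYwc hwx hcx).1⟩, fun hxB => hx ?_⟩, hx⟩, rfl⟩
  exact hA.verts_eq ▸ hB.1.le.1 hxB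

theorem IsCharacteristic.exists_of_mem {i : Bool} {L : V → Fin d} (hA : IsAmalgam Gr S D)
    (hgh : IsCharacteristic P (Gr i) S L g h) {B Y : VGraph V}
    (hB : B ∈ nontrivialBlocks D) (hY : IsBlockOf (Gr i) Y) (hBY : B ≤ Y) {l : Fin d}
    (hl : l ∈ h B) : ∃ x ∈ Y.verts, x ∉ S ∧ L x = l := by
  rw [hgh.neighborhood B (hA.boundaryBlocks_eq i ▸ hB) Y (hA.isSBlock_of_le hY hB hBY) hBY] at hl
  obtain ⟨x, ⟨⟨⟨w, -, hwx⟩, -⟩, hx⟩, hxl⟩ := hl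
  exact ⟨x, hwx.snd_mem, hx, hxl⟩

/-- Each side of a sum whose blocks are isomorphic to chordal graphs `Q B` on labels is modeled by
`Q`. Condition `complete` holds because the neighbors of `w` in a chordal block of the sum induce a
connected graph, and each triangle at `w` lies in one side. -/
theorem IsAmalgam.sideModel_of_sum {L : V → Fin d} {Q : VGraph V → VGraph (Fin d)}
    (hA : IsAmalgam Gr S D) (hfin : (amalgamSum Gr).verts.Finite) {i : Bool}
    (hchord : ∀ Y, IsBlockOf (Gr i) Y → IsChordalGraph Y.coe)
    (hsum : ∀ B ∈ nontrivialBlocks D, ∀ X, IsBlockOf (amalgamSum Gr) X → B ≤ X →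
      Set.InjOn L X.verts ∧ labelGraph X L = Q B ∧ IsChordalGraph X.coe) :
    SideModel (Gr i) S D L Q := by
  have hblock : ∀ Y, IsSBlock (Gr i) S Y → ∃ X, IsBlockOf (amalgamSum Gr) X ∧ Y ≤ X :=
    fun Y hY => hY.1.walkBiconnected.exists_block hfin (hY.1.le.trans (le_amalgamSum Gr i))
  have hadj : ∀ Y, IsSBlock (Gr i) S Y → ∀ X, IsBlockOf (amalgamSum Gr) X → Y ≤ X →
      ∀ x ∈ Y.verts, ∀ y ∈ Y.verts, (Y.Adj x y ↔ X.Adj x y) := by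
    intro Y hY X hX hYX x hx y hy
    refine ⟨fun h => hYX.2 h, fun h => hY.1.adj_of_mem hx hy ?_⟩
    exact hA.adj_of_mem_verts (hY.1.le.1 hx) (hY.1.le.1 hy) (hX.le.2 h)
  refine ⟨hfin.subset (le_amalgamSum Gr i).1, fun Y hY => hchord Y hY.1, ?_, ?_, ?_, ?_, ?_⟩
  · intro Y hY B hB hBY x hx
    obtain ⟨X, hX, hYX⟩ := hblock Y hY
    rw [← (hsum B hB X hX (hBY.trans hYX)).2.1]
    exact ⟨x, hYX.1 hx, rfl⟩
  · intro Y hY B hB hBY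
    obtain ⟨X, hX, hYX⟩ := hblock Y hY
    exact (hsum B hB X hX (hBY.trans hYX)).1.mono hYX.1
  · intro Y hY B hB hBY x hx y hy
    obtain ⟨X, hX, hYX⟩ := hblock Y hY
    obtain ⟨hinj, heq, -⟩ := hsum B hB X hX (hBY.trans hYX)
    rw [← heq, labelGraph_adj hinj (hYX.1 hx) (hYX.1 hy), hadj Y hY X hX hYX x hx y hy]
  · intro Y hY B hB hBY B' hB' hB'Y
    obtain ⟨X, hX, hYX⟩ := hblock Y hY
    rw [← (hsum B hB X hX (hBY.trans hYX)).2.1, (hsum B' hB' X hX (hB'Y.trans hYX)).2.1]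
  · intro Y hY B hB hBY w hw hwD l hl
    obtain ⟨X, hX, hYX⟩ := hblock Y hY
    obtain ⟨hinj, heq, hchX⟩ := hsum B hB X hX (hBY.trans hYX)
    rw [← heq] at hl
    obtain ⟨y, hy, rfl⟩ := hl.snd_mem
    rw [labelGraph_adj hinj (hYX.1 hw) hy] at hl
    refine ⟨y, ?_, rfl⟩
    obtain ⟨a, hwa⟩ : ∃ a, Y.Adj w a := by
      obtain ⟨p, hp, q, hq, hpq⟩ := hB.2
      by_cases hpw : p = w
      · exact hY.1.walkBiconnected.exists_adj hw (hBY.1 hq) (hpw ▸ hpq)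
      · exact hY.1.walkBiconnected.exists_adj hw (hBY.1 hp) (Ne.symm hpw)
    have hXwa := hYX.2 hwa
    have hreach := hchX.neighborGraph_reachable hXwa hl (hX.walkBiconnected.avoid w a hXwa.snd_mem
      y hl.snd_mem hXwa.ne.symm hl.ne.symm)
    rw [SimpleGraph.reachable_iff_reflTransGen] at hreach
    clear hl hy
    induction hreach with
    | refl => exact hwa
    | @tail p q _ hpq ih =>
      obtain ⟨j, hjp, hjq, hjpq⟩ := hA.exists_triangle (hX.le.2 hpq.2.1) (hX.le.2 hpq.2.2)
        (hX.le.2 hpq.1)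
      by_cases hij : i = j
      · subst hij
        exact (hY.1.adj_of_triangle ih hjq hjpq).1
      · have hip := hY.1.le.2 ih
        exact absurd (hA.adj_of_ne hij hip.fst_mem hip.snd_mem hjp) (hwD p ih)

end Characteristic

/-! ### Exchanging one side of a sum -/

section Exchange

variable {V : Type u} {d : ℕ}

/-- `G` and `H` as a family of two sides. -/
def sides (G H : VGraph V) : Bool → VGraph V
  | false => G
  | true => H

theorem sumLabel_eqOn_left (G : VGraph V) (LG LH : V → Fin d) :
    Set.EqOn (sumLabel G LG LH) LG G.verts := fun _ hx => if_pos hx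

variable {S : Set V} {G H : VGraph V} {LG LH : V → Fin d}

theorem Compatible.isAmalgam (hc : Compatible S G LG H LH) :
    IsAmalgam (sides G H) S (H.induce S) := by
  have hmem : ∀ x ∈ G.verts, x ∈ H.verts → x ∈ S := by
    intro x hxG hxH
    by_contra hxS
    exact Set.disjoint_left.1 hc.disjoint ⟨hxG, hxS⟩ ⟨hxH, hxS⟩
  refine ⟨?_, ?_, ?_⟩
  · rintro (_ | _)
    exacts [hc.subset_left, hc.subset_right]
  · rintro (_ | _) (_ | _) hij x hx hx'
    exacts [absurd rfl hij, hmem x hx hx', hmem x hx' hx, absurd rfl hij]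
  · rintro (_ | _)
    exacts [hc.induce_eq, rfl]

theorem Compatible.sumLabel_eqOn_right (hc : Compatible S G LG H LH) :
    Set.EqOn (sumLabel G LG LH) LH H.verts := by
  intro x hx
  by_cases hxG : x ∈ G.verts
  · rw [sumLabel_eqOn_left G LG LH hxG]
    exact hc.label_eq (hc.isAmalgam.mem_of_ne false true (by decide) x hxG hx)
  · exact if_neg hxG

variable {P : GraphClass.{u}} {G₁ G₂ : VGraph V} {L₁ L₂ : V → Fin d}
  {g : VGraph V → LabeledGraph.{u} d} {h : VGraph V → Set (Fin d)}

/-- In a sum that respects `g`, the graph of labels of a block containing `B` is that of `g B`. -/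
theorem block_sum_label (hPch : P.Chordal) (hc₁ : Compatible S G₁ L₁ H LH)
    (hsum : IsLabeledPBlockGraph P (boundariedSum G₁ H) (sumLabel G₁ L₁ LH))
    (hresp : SumRespects S G₁ L₁ H LH g) :
    ∀ B ∈ nontrivialBlocks (H.induce S), ∀ X, IsBlockOf (amalgamSum (sides G₁ H)) X → B ≤ X →
      Set.InjOn (sumLabel G₁ L₁ LH) X.verts ∧
        labelGraph X (sumLabel G₁ L₁ LH) = modelGraph g B ∧ IsChordalGraph X.coe := by
  intro B hB X hX hBX
  refine ⟨hsum.2.1 X hX, LabelIso.labelGraph_eq ?_, hPch _ (hsum.2.2 X hX)⟩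
  obtain ⟨x, y, hxy⟩ := exists_adj_of_mem_nontrivialBlocks hB
  exact hresp B (hc₁.isAmalgam.boundaryBlocks_eq false ▸ hB) X
    (hc₁.isAmalgam.isSBlock_sum_iff.2 ⟨hX, x, y, hBX.2 hxy, hB.1.le.2 hxy⟩) hBX

/-- If `G₁` and `G₂` have the same characteristic and the sum of `G₁` and `H` respects it, then the
graphs `g B` model the sum of `G₂` and `H`. The sum with `G₁` shows that the model fits `H`; the
sets `h B` are used to pass between neighbors of `B` in `G₁` and in `G₂`. -/
theorem boundaryModel_exchange (hPch : P.Chordal)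
    (hG₁ : IsLabeledPBlockGraph P G₁ L₁) (hG₂ : IsLabeledPBlockGraph P G₂ L₂)
    (hH : IsLabeledPBlockGraph P H LH)
    (hc₁ : Compatible S G₁ L₁ H LH) (hc₂ : Compatible S G₂ L₂ H LH)
    (hgh₁ : IsCharacteristic P G₁ S L₁ g h) (hgh₂ : IsCharacteristic P G₂ S L₂ g h)
    (hsum : IsLabeledPBlockGraph P (boundariedSum G₁ H) (sumLabel G₁ L₁ LH))
    (hresp : SumRespects S G₁ L₁ H LH g) :
    BoundaryModel (sides G₂ H) S (H.induce S) (sumLabel G₂ L₂ LH) (modelGraph g) := by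
  have hA₁ := hc₁.isAmalgam
  have hA₂ := hc₂.isAmalgam
  have hR := block_sum_label hPch hc₁ hsum hresp
  have hmemU : ∀ B ∈ nontrivialBlocks (H.induce S), (g B).MemU P := fun B hB =>
    hgh₂.memU B (hA₂.boundaryBlocks_eq false ▸ hB)
  have hside₂ : SideModel G₂ S (H.induce S) (sumLabel G₂ L₂ LH) (modelGraph g) :=
    (IsCharacteristic.sideModel (i := false) hPch hA₂ hG₂ hgh₂).congr (sumLabel_eqOn_left G₂ L₂ LH)
  have hHlabel : Set.EqOn (sumLabel G₂ L₂ LH) (sumLabel G₁ L₁ LH) H.verts := fun x hx =>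
    (hc₂.sumLabel_eqOn_right hx).trans (hc₁.sumLabel_eqOn_right hx).symm
  have hsideH : SideModel H S (H.induce S) (sumLabel G₂ L₂ LH) (modelGraph g) :=
    (hA₁.sideModel_of_sum (i := true) hsum.1 (fun Y hY => hPch _ (hH.2.2 Y hY)) hR).congr hHlabel
  -- The block of `G₁`, and that of its sum with `H`, that contain `B`.
  have hblocks : ∀ B ∈ nontrivialBlocks (H.induce S), ∀ w c, B.Adj w c →
      ∃ Y X, IsBlockOf G₁ Y ∧ IsBlockOf (amalgamSum (sides G₁ H)) X ∧ B ≤ Y ∧ Y ≤ X := by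
    intro B hB w c hwc
    obtain ⟨Y, hY, hYwc⟩ := exists_block_of_adj hG₁.1 ((hA₁.le false).2 (hB.1.le.2 hwc))
    obtain ⟨X, hX, hYX⟩ := hY.walkBiconnected.exists_block hsum.1
      (hY.le.trans (le_amalgamSum (sides G₁ H) false))
    exact ⟨Y, X, hY, hX, hA₁.le_of_adj (i := false) hY hB hwc hYwc, hYX⟩
  have hsep : ∀ B ∈ nontrivialBlocks (H.induce S), ∀ w c x y, B.Adj w c → G₂.Adj w x →
      G₂.Adj c x → H.Adj w y → H.Adj c y → x ∉ S → y ∉ S →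
      sumLabel G₂ L₂ LH x ≠ sumLabel G₂ L₂ LH y ∧
        ¬ (modelGraph g B).Adj (sumLabel G₂ L₂ LH x) (sumLabel G₂ L₂ LH y) := by
    intro B hB w c x y hwc hwx hcx hwy hcy hx hy
    obtain ⟨Y, X, hY, hX, hBY, hYX⟩ := hblocks B hB w c hwc
    have hxh := IsCharacteristic.label_mem_of_adj (i := false) hA₂ hG₂.1 hgh₂ hB hwc hwx hcx hx
    obtain ⟨x₁, hx₁Y, hx₁S, hx₁⟩ :=
      IsCharacteristic.exists_of_mem (i := false) hA₁ hgh₁ hB hY hBY hxh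
    obtain ⟨hinj, heq, -⟩ := hR B hB X hX (hBY.trans hYX)
    have hyX := (hX.adj_of_triangle (hYX.2 (hBY.2 hwc))
      ((le_amalgamSum (sides G₁ H) true).2 hwy)
      ((le_amalgamSum (sides G₁ H) true).2 hcy)).1.snd_mem
    have hlx : sumLabel G₂ L₂ LH x = sumLabel G₁ L₁ LH x₁ := by
      rw [sumLabel_eqOn_left G₂ L₂ LH hwx.snd_mem, sumLabel_eqOn_left G₁ L₁ LH (hY.le.1 hx₁Y), hx₁]
    have hx₁H : x₁ ∉ H.verts := fun h =>
      hx₁S (hA₁.mem_of_ne false true (by decide) x₁ (hY.le.1 hx₁Y) h)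
    have hyG : y ∉ G₁.verts := fun h =>
      hy (hA₁.mem_of_ne false true (by decide) y h hwy.snd_mem)
    rw [hlx, hHlabel hwy.snd_mem, ← heq, labelGraph_adj hinj (hYX.1 hx₁Y) hyX]
    refine ⟨fun h => ?_, fun h => ?_⟩
    · rw [hinj (hYX.1 hx₁Y) hyX h] at hx₁H
      exact hx₁H hwy.snd_mem
    · rcases amalgamSum_adj.1 (hX.le.2 h) with ⟨_ | _, hi⟩
      exacts [hyG hi.snd_mem, hx₁H hi.fst_mem]
  refine ⟨?_, fun B hB => ?_, fun B hB => ?_, ?_, ?_⟩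
  · rintro (_ | _)
    exacts [hside₂, hsideH]
  · exact (isBiconnected_iff.1 (hmemU B hB).2).labelGraph (hmemU B hB).injOn
  · exact IsChordalGraph.labelGraph (hPch _ (hmemU B hB).mem_class) (hmemU B hB).injOn
  · rintro B hB (_ | _) (_ | _) hij w c x y hwc hwx hcx hwy hcy hx hy
    · exact absurd rfl hij
    · exact hsep B hB w c x y hwc hwx hcx hwy hcy hx hy
    · have := hsep B hB w c y x hwc hwy hcy hwx hcx hy hx
      exact ⟨this.1.symm, fun h => this.2 h.symm⟩
    · exact absurd rfl hij
  · intro B hB w c l hwc hwl hcl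
    obtain ⟨Y, X, hY, hX, hBY, hYX⟩ := hblocks B hB w c hwc
    obtain ⟨hinj, heq, -⟩ := hR B hB X hX (hBY.trans hYX)
    have hwcD := (hA₁.adj_iff true).1 (hB.1.le.2 hwc)
    have hXwc := hYX.2 (hBY.2 hwc)
    have hadj : ∃ y, X.Adj w y ∧ X.Adj c y ∧ sumLabel G₁ L₁ LH y = l := by
      rw [hHlabel hwcD.2.2.fst_mem, ← heq] at hwl
      rw [hHlabel hwcD.2.2.snd_mem, ← heq] at hcl
      obtain ⟨y, hy, rfl⟩ := hwl.snd_mem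
      exact ⟨y, (labelGraph_adj hinj hXwc.fst_mem hy).1 hwl,
        (labelGraph_adj hinj hXwc.snd_mem hy).1 hcl, rfl⟩
    obtain ⟨y, hwy, hcy, hyl⟩ := hadj
    by_cases hyH : y ∈ H.verts
    · exact ⟨y, true, hA₁.adj_of_mem_verts (i := true) hwcD.2.2.fst_mem hyH (hX.le.2 hwy),
        hA₁.adj_of_mem_verts (i := true) hwcD.2.2.snd_mem hyH (hX.le.2 hcy),
        (hHlabel hyH).trans hyl⟩
    · have hG : ∀ z, X.Adj z y → G₁.Adj z y := by
        intro z hz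
        rcases amalgamSum_adj.1 (hX.le.2 hz) with ⟨_ | _, hi⟩
        exacts [hi, absurd hi.snd_mem hyH]
      have hyh := IsCharacteristic.label_mem_of_adj (i := false) hA₁ hG₁.1 hgh₁ hB hwc
        (hG w hwy) (hG c hcy) (fun hyS => hyH (hA₁.subset true hyS))
      rw [← sumLabel_eqOn_left G₁ L₁ LH (hG w hwy).snd_mem, hyl] at hyh
      obtain ⟨Z, hZ, hZwc⟩ := exists_block_of_adj hG₂.1 ((hA₂.le false).2 (hB.1.le.2 hwc))
      have hBZ := hA₂.le_of_adj (i := false) hZ hB hwc hZwc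
      obtain ⟨z, hzZ, -, hzl⟩ :=
        IsCharacteristic.exists_of_mem (i := false) hA₂ hgh₂ hB hZ hBZ hyh
      have hzl' : sumLabel G₂ L₂ LH z = l :=
        (sumLabel_eqOn_left G₂ L₂ LH (hZ.le.1 hzZ)).trans hzl
      have hiff := hside₂.adj_iff Z (hA₂.isSBlock_of_le (i := false) hZ hB hBZ) B hB hBZ
      refine ⟨z, false, hZ.le.2 ((hiff w hZwc.fst_mem z hzZ).2 ?_),
        hZ.le.2 ((hiff c hZwc.snd_mem z hzZ).2 ?_), hzl'⟩
      · rwa [hzl']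
      · rwa [hzl']

end Exchange

theorem mainTheorem6 {V : Type u} (d : ℕ) (hd : 2 ≤ d)
    (P : GraphClass.{u}) (hPiso : P.IsoClosed) (hPher : P.BlockHereditary) (hPch : P.Chordal)
    (S : Set V) (G₁ G₂ H : VGraph V) (L₁ L₂ LH : V → Fin d)
    (hG₁ : IsLabeledPBlockGraph P G₁ L₁)
    (hG₂ : IsLabeledPBlockGraph P G₂ L₂)
    (hH : IsLabeledPBlockGraph P H LH)
    (hc₁ : Compatible S G₁ L₁ H LH)
    (hc₂ : Compatible S G₂ L₂ H LH)
    (g : VGraph V → LabeledGraph.{u} d) (h : VGraph V → Set (Fin d))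
    (hgh₁ : IsCharacteristic P G₁ S L₁ g h)
    (hgh₂ : IsCharacteristic P G₂ S L₂ g h)
    (hAux : (auxSum G₂ H S).coe.IsAcyclic)
    (hsum : IsLabeledPBlockGraph P (boundariedSum G₁ H) (sumLabel G₁ L₁ LH))
    (hresp : SumRespects S G₁ L₁ H LH g) :
    IsLabeledPBlockGraph P (boundariedSum G₂ H) (sumLabel G₂ L₂ LH) ∧
      SumRespects S G₂ L₂ H LH g := by
  have hA := hc₂.isAmalgam
  have M := boundaryModel_exchange hPch hG₁ hG₂ hH hc₁ hc₂ hgh₁ hgh₂ hsum hresp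
  have hBs := hA.boundaryBlocks_eq false
  have hiso : ∀ B ∈ nontrivialBlocks (H.induce S), ∀ X, IsBlockOf (boundariedSum G₂ H) X →
      B ≤ X → LabelIso X (sumLabel G₂ L₂ LH) (g B).graph (g B).label := by
    intro B hB X hX hBX
    have hinj := (hgh₂.memU B (hBs ▸ hB)).injOn
    obtain ⟨h1, h2, h3⟩ := M.label_isomorphism hA hAux hX hB hBX
    refine exists_iso_of_labels h1 hinj h2 ?_
    intro x hx y hy x' hx' y' hy' hxx' hyy'
    rw [h3 x hx y hy, ← hxx', ← hyy', labelGraph_adj hinj hx' hy']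
  refine ⟨⟨hG₂.1.union hH.1, ?_, ?_⟩, ?_⟩
  · intro X hX
    rcases hA.block_cases M.finite hAux hX with ⟨_ | _, hi⟩ | ⟨B, hB, hBX⟩
    · exact (hG₂.2.1 X hi).congr fun x hx => (sumLabel_eqOn_left G₂ L₂ LH (hi.le.1 hx)).symm
    · exact (hH.2.1 X hi).congr fun x hx => (hc₂.sumLabel_eqOn_right (hi.le.1 hx)).symm
    · exact (M.label_isomorphism hA hAux hX hB hBX).1
  · intro X hX
    rcases hA.block_cases M.finite hAux hX with ⟨_ | _, hi⟩ | ⟨B, hB, hBX⟩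
    · exact hG₂.2.2 X hi
    · exact hH.2.2 X hi
    · obtain ⟨e, -⟩ := hiso B hB X hX hBX
      exact hPiso _ _ ⟨e.symm⟩ (hgh₂.memU B (hBs ▸ hB)).mem_class
  · intro B hB X hX hBX
    exact hiso B (hBs ▸ hB) X hX.1 hBX
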